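/- Let $d,M\ge 0$ be integers and let $\mathcal S_0,\mathcal S_1$ be two unitarily invariant sets of density matrices on $\mathbb C^d$ (i.e. $U\rho U^\dagger\in\mathcal S_i$ whenever $\rho\in\mathcal S_i$ and $U\in \mathrm U(d)$). Consider the problem of distinguishing the hypotheses $H_0:\rho\in\mathcal S_0$ and $H_1:\rho\in\mathcal S_1$ from $\rho^{\otimes M}$. A test is an operator $O$ on $(\mathbb C^d)^{\otimes M}$ with $0\le O\le 1$, which accepts $H_0$ with probability $\operatorname{tr}(O\rho^{\otimes M})$; its worst-case type 1 and type 2 errors are $$\alpha(O)=\sup_{\rho\in\mathcal S_0}\bigl(1-\operatorname{tr}(O\rho^{\otimes M})\bigr),\qquad \beta(O)=\sup_{\rho\in\mathcal S_1}\operatorname{tr}(O\rho^{\otimes M})$$ (with the supremum over an empty set read as $0$). For a partition $\lambda$ of $M$, let $\Pi_\lambda$ be the orthogonal projection of $(\mathbb C^d)^{\otimes M}$ onto the isotypic component, for the action of the symmetric group $S_M$ permuting the tensor factors, of the irreducible representation (Specht module) labelled by $\lambda$. Then: 1. $(\Pi_\lambda)_\lambda$ is a projective measurement (weak Schur sampling,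 WSS): the $\Pi_\lambda$ are mutually orthogonal projections with $\sum_\lambda\Pi_\lambda=1$. 2. For every test $O$ there are coefficients $0\le c_\lambda\le 1$ such that $T=\sum_\lambda c_\lambda\Pi_\lambda$ (perform WSS and, on outcome $\lambda$, accept $H_0$ with probability $c_\lambda$) is a test with $\alpha(T)\le\alpha(O)$ and $\beta(T)\le\beta(O)$. 3. WSS is minimax optimal: there are coefficients $0\le c_\lambda\le 1$ such that $T=\sum_\lambda c_\lambda\Pi_\lambda$ is a test with $\max(\alpha(T),\beta(T))\le\max(\alpha(O),\beta(O))$ for every test $O$. -/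

import Mathlib

open scoped Matrix ComplexOrder

noncomputable section

namespace WeakSchur

/-! ### States, tensor powers and tests -/

/-- Operators on `ℂ^d`, as matrices in the standard basis. -/
abbrev Op (d : ℕ) := Matrix (Fin d) (Fin d) ℂ

/-- Operators on `(ℂ^d)^{⊗M}`, as matrices in the product basis `e_{i 0} ⊗ ⋯ ⊗ e_{i (M-1)}`,
`i : Fin M → Fin d`. -/
abbrev TensorOp (d M : ℕ) := Matrix (Fin M → Fin d) (Fin M → Fin d) ℂ

/-- The Hilbert space `(ℂ^d)^{⊗M}`, in coordinates with respect to the (orthonormal) product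
basis. -/
abbrev TensorSpace (d M : ℕ) := EuclideanSpace ℂ (Fin M → Fin d)

/-- The `M`-fold tensor (Kronecker) power `A^{⊗M}`. -/
def tensorPower {d : ℕ} (M : ℕ) (A : Op d) : TensorOp d M :=
  Matrix.of fun i j => ∏ k, A (i k) (j k)

/-- Density matrices. -/
def IsDensity {d : ℕ} (ρ : Op d) : Prop := ρ.PosSemidef ∧ ρ.trace = 1

/-- A unitarily invariant composite hypothesis: a set of states which is closed under
conjugation by unitaries. -/
structure IsUnitarilyInvariantHypothesis {d : ℕ} (S : Set (Op d)) : Prop where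
  isDensity : ∀ ρ ∈ S, IsDensity ρ
  conj_mem : ∀ ρ ∈ S, ∀ U ∈ Matrix.unitaryGroup (Fin d) ℂ, U * ρ * Uᴴ ∈ S

/-- A two-outcome measurement on `(ℂ^d)^{⊗M}`, given by the operator `0 ≤ O ≤ 1` of the outcome
"accept `H₀`"; the operator of the outcome "accept `H₁`" is `1 - O`. -/
def IsTest {d M : ℕ} (O : TensorOp d M) : Prop := O.PosSemidef ∧ (1 - O).PosSemidef

/-- The probability `tr (O ρ^{⊗M})` that the test `O` accepts `H₀` on `M` copies of `ρ`. -/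
def acceptProb {d M : ℕ} (O : TensorOp d M) (ρ : Op d) : ℝ :=
  (O * tensorPower M ρ).trace.re

/-- Worst-case type 1 error: the supremum over `ρ ∈ S₀` of the probability of rejecting `H₀`. -/
def type1Error {d M : ℕ} (S₀ : Set (Op d)) (O : TensorOp d M) : ℝ :=
  ⨆ ρ : S₀, (1 - acceptProb O ρ.1)

/-- Worst-case type 2 error: the supremum over `ρ ∈ S₁` of the probability of accepting `H₀`. -/
def type2Error {d M : ℕ} (S₁ : Set (Op d)) (O : TensorOp d M) : ℝ :=
  ⨆ ρ : S₁, acceptProb O ρ.1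

/-! ### Specht modules -/

/-- The parts of a partition in weakly decreasing order. -/
def rowLengths {M : ℕ} (p : M.Partition) : List ℕ := p.parts.sort (· ≥ ·)

/-- The Young diagram of a partition. -/
def diagram {M : ℕ} (p : M.Partition) : YoungDiagram :=
  YoungDiagram.ofRowLens (rowLengths p) (p.parts.pairwise_sort (· ≥ ·)).sortedGE

theorem card_cellsOfRowLens (w : List ℕ) : (YoungDiagram.cellsOfRowLens w).card = w.sum := by
  induction w with
  | nil => simp [YoungDiagram.cellsOfRowLens]
  | cons a w ih =>
    rw [YoungDiagram.cellsOfRowLens, Finset.card_union_of_disjoint]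
    · simp [ih]
    · rw [Finset.disjoint_left]
      rintro ⟨x, y⟩ h1 h2
      simp at h1 h2
      obtain ⟨a, -, h⟩ := h2
      omega

theorem card_diagram {M : ℕ} (p : M.Partition) : (diagram p).cells.card = M := by
  have h : (rowLengths p).sum = M := by
    rw [← Multiset.sum_coe, rowLengths, Multiset.sort_eq, p.parts_sum]
  exact (card_cellsOfRowLens (rowLengths p)).trans h

/-- A tableau of shape `p`: a bijective labelling of the cells of the diagram. (Another
labelling gives an isomorphic Specht module.) -/
def tableau {M : ℕ} (p : M.Partition) : Fin M ≃ (diagram p).cells :=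
  ((diagram p).cells.equivFinOfCardEq (card_diagram p)).symm

/-- The row of the tableau in which the label `k` stands. -/
def rowOf {M : ℕ} (p : M.Partition) (k : Fin M) : ℕ := (tableau p k).1.1

/-- The column of the tableau in which the label `k` stands. -/
def colOf {M : ℕ} (p : M.Partition) (k : Fin M) : ℕ := (tableau p k).1.2

/-- The group algebra `ℂ[S_M]`. -/
abbrev SymAlg (M : ℕ) := MonoidAlgebra ℂ (Equiv.Perm (Fin M))

/-- The sum of all permutations that preserve each row of the tableau. -/
def rowSymmetrizer {M : ℕ} (p : M.Partition) : SymAlg M :=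
  ∑ g : Equiv.Perm (Fin M) with ∀ k, rowOf p (g k) = rowOf p k, MonoidAlgebra.single g 1

/-- The signed sum of all permutations that preserve each column of the tableau. -/
def colAntisymmetrizer {M : ℕ} (p : M.Partition) : SymAlg M :=
  ∑ g : Equiv.Perm (Fin M) with ∀ k, colOf p (g k) = colOf p k,
    MonoidAlgebra.single g ((Equiv.Perm.sign g : ℤ) : ℂ)

/-- The Specht module of a partition `p` of `M`, i.e. the irreducible representation of `S_M`
labelled by `p`: the left ideal of `ℂ[S_M]` generated by the Young symmetrizer. -/
def Specht {M : ℕ} (p : M.Partition) : Submodule (SymAlg M) (SymAlg M) :=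
  Submodule.span (SymAlg M) {rowSymmetrizer p * colAntisymmetrizer p}

/-! ### Weak Schur sampling -/

/-- The representation of `S_M` on `(ℂ^d)^{⊗M}` by permutation of the tensor factors:
`π (v_0 ⊗ ⋯ ⊗ v_{M-1})` has `v_k` in position `π k`. -/
def permRep (d M : ℕ) : Representation ℂ (Equiv.Perm (Fin M)) (TensorSpace d M) where
  toFun π :=
    { toFun := fun ψ => WithLp.toLp 2 fun i => ψ (i ∘ π)
      map_add' := fun _ _ => rfl
      map_smul' := fun _ _ => rfl }
  map_one' := rfl
  map_mul' := fun _ _ => rfl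

/-- The block of `(ℂ^d)^{⊗M}` labelled by `p` in the Schur-Weyl decomposition: the sum of all
`S_M`-subrepresentations which are isomorphic to the Specht module of `p`. -/
def schurBlock (d : ℕ) {M : ℕ} (p : M.Partition) : Submodule ℂ (TensorSpace d M) :=
  ((isotypicComponent (SymAlg M) (permRep d M).asModule (Specht p)).restrictScalars ℂ).map
    (permRep d M).asModuleEquiv.toLinearMap

/-- The projector `Π_p` of weak Schur sampling: the matrix of the orthogonal projection onto the
block labelled by `p`. -/
def schurProj (d : ℕ) {M : ℕ} (p : M.Partition) : TensorOp d M :=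
  (Matrix.toEuclideanCLM (n := Fin M → Fin d) (𝕜 := ℂ)).symm (schurBlock d p).starProjection

/-- A projective measurement with outcomes in a finite type: mutually orthogonal orthogonal
projections that sum to the identity. -/
structure IsProjectiveMeasurement {d M : ℕ} {Λ : Type*} [Fintype Λ]
    (P : Λ → TensorOp d M) : Prop where
  isStarProjection : ∀ l, IsStarProjection (P l)
  orthogonal : ∀ l m, l ≠ m → P l * P m = 0
  sum_eq_one : ∑ l, P l = 1

/-- The test which performs weak Schur sampling and, on the outcome `p`, accepts `H₀` with
probability `c p`. -/
def wssTest (d : ℕ) {M : ℕ} (c : M.Partition → ℝ) : TensorOp d M :=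
  ∑ p, (c p : ℂ) • schurProj d p

end WeakSchur

end

/-! Fix a test `O`. The tests whose errors on each state of the two hypotheses are bounded by the
worst-case errors of `O` form a closed convex set. It is stable under conjugation by `U^{⊗M}`, since
the hypotheses are unitarily invariant, and under permutation of the tensor factors, since `ρ^{⊗M}`
is symmetric. Its element `T` of least Hilbert-Schmidt norm is unique, hence fixed by all these
symmetries; this replaces Haar averaging (`exists_mem_forall_fixed`).

By one half of Schur-Weyl duality (`commute_of_permInvariant`), commuting with all `U^{⊗M}` forces
`T` to commute with every permutation-invariant operator. As `T` is itself permutation-invariant, it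
is central in the `S_M`-endomorphisms, and therefore a scalar on each Specht-isotypic block
(`exists_forall_mem_isotypicComponent_eq_smul`). Positivity of `T` and `1 - T` puts the scalars in
`[0, 1]`, so `T` is a weak Schur sampling test (`exists_eq_wssTest`).

That the blocks are independent and exhaust the space rests on Young symmetrizers `c_p`: one has
`c_p x c_q = 0` for `p ≠ q`, `c_p x c_p ∈ ℂ c_p` and `c_p² ≠ 0`. Functionals vanishing on
commutators form a space of dimension at most the number of partitions, and the `c_p` separate it,
so a module killed by every `c_p` has zero character and is trivial
(`subsingleton_of_youngSymmetrizer_smul`). Orthogonality follows because permutations act unitarily.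

A minimax test exists because both errors are lower semicontinuous on the compact cube of
coefficients; by the replacement above, the minimum over the cube is the minimum over all tests. -/

noncomputable section

namespace WeakSchur

/-! ### Pairs of tableaux -/

section Tableaux

variable {M : ℕ}

/-- The position with the row of `k` in the tableau of `p` and the column of `k` in the tableau
of `q` translated by `g`. -/
def mixedCell (p q : M.Partition) (g : Equiv.Perm (Fin M)) (k : Fin M) : ℕ × ℕ :=
  (rowOf p k, colOf q (g⁻¹ k))

theorem eq_of_rowOf_eq_of_colOf_eq {p : M.Partition} {k l : Fin M} (hr : rowOf p k = rowOf p l)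
    (hc : colOf p k = colOf p l) : k = l :=
  (tableau p).injective (Subtype.ext (Prod.ext hr hc))

theorem sum_cells {N : Type*} [AddCommMonoid N] (p : M.Partition) (φ : ℕ × ℕ → N) :
    ∑ c ∈ (diagram p).cells, φ c = ∑ k, φ (rowOf p k, colOf p k) := by
  rw [← Finset.sum_coe_sort]
  exact ((tableau p).sum_comp fun c => φ c.1).symm

/-- The weight `φ`, row minus column length in the diagram of `q`, is negative exactly on the cells
of `q`. The image has the same columns with multiplicity and no larger row sum, so its total weight
is at most that of the diagram. A set of equal cardinality missing some cell of `q` would have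
strictly larger weight. Comparing row sums takes the place of the dominance order. -/
theorem image_mixedCell {p q : M.Partition} {g : Equiv.Perm (Fin M)}
    (hinj : Function.Injective (mixedCell p q g)) (hle : ∑ k, rowOf p k ≤ ∑ k, rowOf q k) :
    Finset.univ.image (mixedCell p q g) = (diagram q).cells := by
  set A := Finset.univ.image (mixedCell p q g) with hA
  set B := (diagram q).cells with hB
  let φ : ℕ × ℕ → ℤ := fun c => (c.1 : ℤ) - (diagram q).colLen c.2
  have hφ (c : ℕ × ℕ) : c ∈ B ↔ φ c < 0 := by
    rw [hB, YoungDiagram.mem_cells, YoungDiagram.mem_iff_lt_colLen]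
    simp only [φ]
    omega
  have h1 : ∑ c ∈ A, φ c ≤ ∑ c ∈ B, φ c := by
    rw [hA, Finset.sum_image hinj.injOn, hB, sum_cells]
    simp only [φ, mixedCell, Finset.sum_sub_distrib]
    rw [Equiv.sum_comp g⁻¹ fun k => ((diagram q).colLen (colOf q k) : ℤ)]
    have : (∑ k, (rowOf p k : ℤ)) ≤ ∑ k, (rowOf q k : ℤ) := by exact_mod_cast hle
    omega
  have hcard : A.card = B.card := by
    rw [hA, Finset.card_image_of_injective _ hinj, hB, card_diagram, Finset.card_fin]
  have h2 : 0 ≤ ∑ c ∈ A \ B, φ c := Finset.sum_nonneg fun c hc => by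
    have := (hφ c).not.1 (Finset.mem_sdiff.1 hc).2
    omega
  have h3 : B \ A = ∅ := by
    by_contra h
    have : ∑ c ∈ B \ A, φ c < 0 := Finset.sum_neg
      (fun c hc => (hφ c).1 (Finset.mem_sdiff.1 hc).1) (Finset.nonempty_iff_ne_empty.2 h)
    have := Finset.sum_sdiff_sub_sum_sdiff (s₁ := A) (s₂ := B) (f := φ)
    omega
  exact (Finset.eq_of_subset_of_card_le (Finset.sdiff_eq_empty_iff_subset.1 h3) hcard.le).symm

theorem rowLen_diagram (p : M.Partition) (i : ℕ) :
    (diagram p).rowLen i = (Finset.univ.filter fun k => rowOf p k = i).card := by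
  rw [YoungDiagram.rowLen_eq_card, YoungDiagram.row, Finset.card_filter, Finset.card_filter,
    sum_cells]

theorem diagram_injective : Function.Injective (diagram (M := M)) := by
  intro p q h
  have hlens (p : M.Partition) : (diagram p).rowLens = rowLengths p :=
    YoungDiagram.rowLens_ofRowLens_eq_self fun x hx =>
      p.parts_pos ((Multiset.mem_sort _).1 hx)
  have h' : rowLengths p = rowLengths q := by rw [← hlens, ← hlens, h]
  refine Nat.Partition.ext ?_
  rw [← Multiset.sort_eq p.parts (· ≥ ·), ← Multiset.sort_eq q.parts (· ≥ ·)]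
  exact congrArg _ h'

theorem eq_of_injective_mixedCell {p q : M.Partition} {g : Equiv.Perm (Fin M)}
    (hinj : Function.Injective (mixedCell p q g)) (hle : ∑ k, rowOf p k ≤ ∑ k, rowOf q k) :
    p = q := by
  -- The image of `mixedCell` is the diagram of `q`, yet its row counts are those of `p`.
  have hrow (i : ℕ) : (diagram p).rowLen i = (diagram q).rowLen i := by
    rw [rowLen_diagram, (diagram q).rowLen_eq_card, YoungDiagram.row, ← image_mixedCell hinj hle,
      Finset.filter_image, Finset.card_image_of_injective _ hinj]
    rfl
  refine diagram_injective (YoungDiagram.ext (Finset.ext fun c => ?_))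
  rw [YoungDiagram.mem_cells, YoungDiagram.mem_cells, ← Prod.mk.eta (p := c),
    YoungDiagram.mem_iff_lt_rowLen, YoungDiagram.mem_iff_lt_rowLen, hrow]

theorem exists_factorization {p : M.Partition} {g : Equiv.Perm (Fin M)}
    (hinj : Function.Injective (mixedCell p p g)) :
    ∃ r s : Equiv.Perm (Fin M), (∀ k, rowOf p (r k) = rowOf p k) ∧
      (∀ k, colOf p (s k) = colOf p k) ∧ g = r * s := by
  have hmem (k : Fin M) : mixedCell p p g k ∈ (diagram p).cells := by
    rw [← image_mixedCell hinj le_rfl]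
    exact Finset.mem_image_of_mem _ (Finset.mem_univ k)
  -- Each label goes to the label standing in its mixed cell: its row is kept, and its column
  -- becomes that of `g⁻¹ k`. Hence `r` preserves rows and `r * g` preserves columns.
  let f : Fin M → Fin M := fun k => (tableau p).symm ⟨_, hmem k⟩
  have hf : Function.Injective f := fun k l h => hinj (congrArg Subtype.val
    ((tableau p).symm.injective h))
  let r : Equiv.Perm (Fin M) := Equiv.ofBijective f (Finite.injective_iff_bijective.1 hf)
  have hT (k : Fin M) : (tableau p (r k)).1 = mixedCell p p g k := by
    simp [r, f]
  have hrow (k : Fin M) : rowOf p (r k) = rowOf p k := (congrArg Prod.fst (hT k) :)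
  have hcol (k : Fin M) : colOf p (r k) = colOf p (g⁻¹ k) := (congrArg Prod.snd (hT k) :)
  refine ⟨r⁻¹, r * g, fun k => ?_, fun k => ?_, by group⟩
  · simpa using (hrow (r⁻¹ k)).symm
  · simpa using hcol (g k)

/-- If the row of some pair in the tableau of `p` and the column of this pair in the translated
tableau of `q` coincide, then a transposition preserves both. -/
theorem exists_swap_of_not_injective {p q : M.Partition} {g : Equiv.Perm (Fin M)}
    (h : ¬ Function.Injective (mixedCell p q g)) :
    ∃ t u : Equiv.Perm (Fin M), (∀ k, rowOf p (t k) = rowOf p k) ∧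
      (∀ k, colOf q (u k) = colOf q k) ∧ Equiv.Perm.sign u = -1 ∧ t * g = g * u := by
  simp only [Function.Injective, not_forall] at h
  obtain ⟨k, l, hkl, hne⟩ := h
  have hr : rowOf p k = rowOf p l := (congrArg Prod.fst hkl :)
  have hc : colOf q (g⁻¹ k) = colOf q (g⁻¹ l) := (congrArg Prod.snd hkl :)
  refine ⟨Equiv.swap k l, Equiv.swap (g⁻¹ k) (g⁻¹ l), fun m => ?_, fun m => ?_, ?_, ?_⟩
  · rw [Equiv.swap_apply_def]; split_ifs with h1 h2 <;> simp_all
  · rw [Equiv.swap_apply_def]; split_ifs with h1 h2 <;> simp_all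
  · exact Equiv.Perm.sign_swap (by simpa using hne)
  · rw [Equiv.mul_swap_eq_swap_mul]; simp

end Tableaux

/-! ### Young symmetrizers -/

section YoungSymmetrizer

open MonoidAlgebra

variable {M : ℕ}

theorem single_mul_rowSymmetrizer {p : M.Partition} {r : Equiv.Perm (Fin M)}
    (hr : ∀ k, rowOf p (r k) = rowOf p k) :
    (single r 1 : SymAlg M) * rowSymmetrizer p = rowSymmetrizer p := by
  simp only [rowSymmetrizer, Finset.mul_sum, single_mul_single, mul_one]
  refine Finset.sum_equiv (Equiv.mulLeft r) (fun g => ?_) fun g _ => rfl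
  simp [hr]

theorem rowSymmetrizer_mul_single {p : M.Partition} {r : Equiv.Perm (Fin M)}
    (hr : ∀ k, rowOf p (r k) = rowOf p k) :
    rowSymmetrizer p * (single r 1 : SymAlg M) = rowSymmetrizer p := by
  simp only [rowSymmetrizer, Finset.sum_mul, single_mul_single, mul_one]
  refine Finset.sum_equiv (Equiv.mulRight r) (fun g => ?_) fun g _ => rfl
  simp only [Finset.mem_filter, Finset.mem_univ, true_and, Equiv.coe_mulRight, Equiv.Perm.mul_apply]
  rw [← r.forall_congr_right (q := fun k => rowOf p (g k) = rowOf p k)]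
  simp [hr]

theorem single_mul_colAntisymmetrizer {p : M.Partition} {s : Equiv.Perm (Fin M)}
    (hs : ∀ k, colOf p (s k) = colOf p k) :
    (single s 1 : SymAlg M) * colAntisymmetrizer p =
      ((Equiv.Perm.sign s : ℤ) : ℂ) • colAntisymmetrizer p := by
  simp only [colAntisymmetrizer, Finset.mul_sum, Finset.smul_sum, single_mul_single, one_mul,
    smul_single]
  refine Finset.sum_equiv (Equiv.mulLeft s) (fun g => ?_) fun g _ => ?_
  · simp [hs]
  · rcases Int.units_eq_one_or (Equiv.Perm.sign s) with h | h <;> simp [h]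

theorem colAntisymmetrizer_mul_single {p : M.Partition} {s : Equiv.Perm (Fin M)}
    (hs : ∀ k, colOf p (s k) = colOf p k) :
    colAntisymmetrizer p * (single s 1 : SymAlg M) =
      ((Equiv.Perm.sign s : ℤ) : ℂ) • colAntisymmetrizer p := by
  simp only [colAntisymmetrizer, Finset.sum_mul, Finset.smul_sum, single_mul_single, mul_one,
    smul_single]
  refine Finset.sum_equiv (Equiv.mulRight s) (fun g => ?_) fun g _ => ?_
  · simp only [Finset.mem_filter, Finset.mem_univ, true_and, Equiv.coe_mulRight,
      Equiv.Perm.mul_apply]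
    rw [← s.forall_congr_right (q := fun k => colOf p (g k) = colOf p k)]
    simp [hs]
  · rcases Int.units_eq_one_or (Equiv.Perm.sign s) with h | h <;> simp [h]

/-- The Young symmetrizer of a partition. -/
def youngSymmetrizer (p : M.Partition) : SymAlg M := rowSymmetrizer p * colAntisymmetrizer p

theorem eq_zero_of_eq_neg {x : SymAlg M} (h : x = -x) : x = 0 := by
  have h2 : (2 : ℂ) • x = 0 := by rw [two_smul, add_eq_zero_iff_eq_neg]; exact h
  exact (smul_eq_zero.1 h2).resolve_left two_ne_zero

/-- A transposition absorbed by the row symmetrizer on the left turns, moved past `g`, into one that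
the column antisymmetrizer absorbs with sign `-1`. -/
theorem rowSymmetrizer_mul_single_mul_colAntisymmetrizer_eq_zero {p q : M.Partition}
    {g : Equiv.Perm (Fin M)} (h : ¬ Function.Injective (mixedCell p q g)) :
    rowSymmetrizer p * single g 1 * colAntisymmetrizer q = 0 := by
  obtain ⟨t, u, ht, hu, hsign, htu⟩ := exists_swap_of_not_injective h
  refine eq_zero_of_eq_neg ?_
  calc
    _ = rowSymmetrizer p * (single t 1 * single g 1) * colAntisymmetrizer q := by
      rw [← mul_assoc (rowSymmetrizer p), rowSymmetrizer_mul_single ht]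
    _ = rowSymmetrizer p * single g 1 * (single u 1 * colAntisymmetrizer q) := by
      rw [single_mul_single, htu, ← single_mul_single]; simp only [mul_assoc]
    _ = _ := by rw [single_mul_colAntisymmetrizer hu, hsign]; simp

theorem colAntisymmetrizer_mul_single_mul_rowSymmetrizer_eq_zero {p q : M.Partition}
    {g : Equiv.Perm (Fin M)} (h : ¬ Function.Injective (mixedCell p q g⁻¹)) :
    colAntisymmetrizer q * single g 1 * rowSymmetrizer p = 0 := by
  obtain ⟨t, u, ht, hu, hsign, htu⟩ := exists_swap_of_not_injective h
  have hgt : g * t = u * g := by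
    rw [mul_inv_eq_iff_eq_mul, mul_assoc] at htu
    rw [htu]; group
  refine eq_zero_of_eq_neg ?_
  calc
    _ = colAntisymmetrizer q * (single g 1 * single t 1) * rowSymmetrizer p := by
      rw [mul_assoc, mul_assoc, mul_assoc, single_mul_rowSymmetrizer ht]
    _ = colAntisymmetrizer q * single u 1 * single g 1 * rowSymmetrizer p := by
      rw [single_mul_single, hgt, ← single_mul_single]; simp only [mul_assoc]
    _ = _ := by rw [colAntisymmetrizer_mul_single hu, hsign]; simp

/-- By linearity `x` is a permutation. Either it factors as row-preserving times column-preserving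
and both factors are absorbed up to sign, or the product vanishes. -/
theorem exists_rowSymmetrizer_mul_mul_colAntisymmetrizer (p : M.Partition) (x : SymAlg M) :
    ∃ z : ℂ, rowSymmetrizer p * x * colAntisymmetrizer p = z • youngSymmetrizer p := by
  induction x using MonoidAlgebra.induction_linear with
  | zero => exact ⟨0, by simp⟩
  | add x y hx hy =>
    obtain ⟨a, ha⟩ := hx
    obtain ⟨b, hb⟩ := hy
    exact ⟨a + b, by rw [mul_add, add_mul, ha, hb, add_smul]⟩
  | single g c =>
    have hc : (single g c : SymAlg M) = c • single g 1 := by simp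
    by_cases h : Function.Injective (mixedCell p p g)
    · obtain ⟨r, s, hr, hs, rfl⟩ := exists_factorization h
      refine ⟨c * ((Equiv.Perm.sign s : ℤ) : ℂ), ?_⟩
      rw [hc, mul_smul_comm, smul_mul_assoc, mul_smul,
        show (single (r * s) 1 : SymAlg M) = single r 1 * single s 1 by simp [single_mul_single],
        ← mul_assoc, rowSymmetrizer_mul_single hr, mul_assoc, single_mul_colAntisymmetrizer hs,
        mul_smul_comm, youngSymmetrizer]
    · refine ⟨0, ?_⟩
      rw [hc, mul_smul_comm, smul_mul_assoc,
        rowSymmetrizer_mul_single_mul_colAntisymmetrizer_eq_zero h, smul_zero, zero_smul]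

theorem exists_youngSymmetrizer_mul_mul (p : M.Partition) (x : SymAlg M) :
    ∃ z : ℂ, youngSymmetrizer p * x * youngSymmetrizer p = z • youngSymmetrizer p := by
  obtain ⟨z, hz⟩ := exists_rowSymmetrizer_mul_mul_colAntisymmetrizer p
    (colAntisymmetrizer p * x * rowSymmetrizer p)
  exact ⟨z, by rw [← hz]; simp only [youngSymmetrizer, mul_assoc]⟩

theorem mul_mul_eq_zero_of_single {a b : SymAlg M}
    (h : ∀ g : Equiv.Perm (Fin M), a * single g 1 * b = 0) (x : SymAlg M) : a * x * b = 0 := by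
  induction x using MonoidAlgebra.induction_linear with
  | zero => simp
  | add x y hx hy => rw [mul_add, add_mul, hx, hy, add_zero]
  | single g c =>
    rw [show (single g c : SymAlg M) = c • single g 1 by simp, mul_smul_comm, smul_mul_assoc, h,
      smul_zero]

/-- The row sums decide which factor vanishes: the outer one, row symmetrizer of `p` against column
antisymmetrizer of `q`, or the inner one, column antisymmetrizer of `p` against row symmetrizer of
`q`. -/
theorem youngSymmetrizer_mul_mul_eq_zero {p q : M.Partition} (hpq : p ≠ q) (x : SymAlg M) :
    youngSymmetrizer p * x * youngSymmetrizer q = 0 := by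
  rcases le_total (∑ k, rowOf p k) (∑ k, rowOf q k) with hle | hle
  · have h := mul_mul_eq_zero_of_single (fun g =>
      rowSymmetrizer_mul_single_mul_colAntisymmetrizer_eq_zero
        (fun hinj => hpq (eq_of_injective_mixedCell (g := g) hinj hle)))
      (colAntisymmetrizer p * x * rowSymmetrizer q)
    simpa only [youngSymmetrizer, mul_assoc] using h
  · have h := mul_mul_eq_zero_of_single (fun g =>
      colAntisymmetrizer_mul_single_mul_rowSymmetrizer_eq_zero
        (fun hinj => hpq.symm (eq_of_injective_mixedCell (g := g⁻¹) hinj hle))) x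
    calc
      _ = rowSymmetrizer p * (colAntisymmetrizer p * x * rowSymmetrizer q) *
          colAntisymmetrizer q := by simp only [youngSymmetrizer, mul_assoc]
      _ = 0 := by rw [h]; simp

/-- Only the identity preserves both the rows and the columns of a tableau. -/
theorem coeff_youngSymmetrizer_one (p : M.Partition) : (youngSymmetrizer p).coeff 1 = 1 := by
  simp only [youngSymmetrizer, rowSymmetrizer, colAntisymmetrizer, Finset.sum_mul_sum,
    single_mul_single, one_mul, coeff_sum, Finsupp.coe_finsetSum, Finset.sum_apply, coeff_single,
    Finsupp.single_apply]
  rw [Finset.sum_eq_single 1, Finset.sum_eq_single 1]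
  · simp
  · intro h _ hh
    simp [hh]
  · simp
  · intro g hg hg1
    refine Finset.sum_eq_zero fun h hh => if_neg fun hgh => hg1 ?_
    simp only [Finset.mem_filter, Finset.mem_univ, true_and] at hg hh
    obtain rfl : h = g⁻¹ := (inv_eq_of_mul_eq_one_right hgh).symm
    refine Equiv.ext fun k => eq_of_rowOf_eq_of_colOf_eq (hg k) ?_
    simpa using (hh (g k)).symm
  · simp

theorem youngSymmetrizer_ne_zero (p : M.Partition) : youngSymmetrizer p ≠ 0 := by
  intro h
  simpa [h] using coeff_youngSymmetrizer_one p

theorem trace_mulLeft (x : SymAlg M) :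
    LinearMap.trace ℂ (SymAlg M) (LinearMap.mulLeft ℂ x) = M.factorial * x.coeff 1 := by
  rw [LinearMap.trace_eq_matrix_trace ℂ (MonoidAlgebra.basis (Equiv.Perm (Fin M)) ℂ), Matrix.trace]
  have h (g : Equiv.Perm (Fin M)) : (LinearMap.toMatrix (MonoidAlgebra.basis (Equiv.Perm (Fin M)) ℂ)
      (MonoidAlgebra.basis (Equiv.Perm (Fin M)) ℂ) (LinearMap.mulLeft ℂ x)).diag g = x.coeff 1 := by
    rw [Matrix.diag_apply, LinearMap.toMatrix_apply, basis_apply, LinearMap.mulLeft_apply]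
    change (x * single g 1).coeff g = _
    simp
  rw [Finset.sum_congr rfl fun g _ => h g]
  simp [Fintype.card_perm]

/-- Otherwise left multiplication by the symmetrizer would be nilpotent, while its trace is `M!`. -/
theorem youngSymmetrizer_mul_self_ne_zero (p : M.Partition) :
    youngSymmetrizer p * youngSymmetrizer p ≠ 0 := by
  intro h
  have hnil : IsNilpotent (LinearMap.mulLeft ℂ (youngSymmetrizer p)) :=
    ⟨2, by rw [pow_two, Module.End.mul_eq_comp, ← LinearMap.mulLeft_mul, h]; simp⟩
  have := (LinearMap.isNilpotent_trace_of_isNilpotent hnil).eq_zero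
  rw [trace_mulLeft, coeff_youngSymmetrizer_one, mul_one] at this
  exact M.factorial_ne_zero (by exact_mod_cast this)

end YoungSymmetrizer

/-! ### Trace functionals on the group algebra -/

section TraceFunctional

open MonoidAlgebra

variable {M : ℕ}

/-- The linear functionals on the group algebra that vanish on all commutators. -/
def traceFunctional (M : ℕ) : Submodule ℂ (SymAlg M →ₗ[ℂ] ℂ) where
  carrier := {f | ∀ x y, f (x * y) = f (y * x)}
  add_mem' hf hg x y := by simp [hf x y, hg x y]
  zero_mem' _ _ := rfl
  smul_mem' c f hf x y := by simp [hf x y]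

theorem traceFunctional_single_eq_of_isConj {f : SymAlg M →ₗ[ℂ] ℂ} (hf : f ∈ traceFunctional M)
    {g h : Equiv.Perm (Fin M)} (hgh : IsConj g h) : f (single g 1) = f (single h 1) := by
  obtain ⟨c, rfl⟩ := isConj_iff.1 hgh
  have := hf (single (c * g) 1) (single c⁻¹ 1)
  rw [single_mul_single, single_mul_single, mul_one] at this
  rw [this]
  congr 2
  group

/-- Such a functional is constant on conjugacy classes, and these are distinguished by cycle type.
-/
theorem finrank_traceFunctional_le :
    Module.finrank ℂ (traceFunctional M) ≤ Fintype.card M.Partition := by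
  classical
  let P := (Fintype.card (Fin M)).Partition
  have hcard : Fintype.card P = Fintype.card M.Partition := by
    simp only [P, Fintype.card_fin]
  -- Evaluation at one permutation of each cycle type. The default `0` is harmless: injectivity uses
  -- only cycle types that occur.
  let G : traceFunctional M →ₗ[ℂ] (P → ℂ) := LinearMap.pi fun m =>
    if h : ∃ g : Equiv.Perm (Fin M), g.partition = m then
      (LinearMap.applyₗ (single h.choose 1 : SymAlg M)).comp (traceFunctional M).subtype
    else 0
  have hG : Function.Injective G := by
    rw [injective_iff_map_eq_zero]
    intro f hf
    refine Subtype.ext (MonoidAlgebra.lhom_ext' fun g => LinearMap.ext_ring ?_)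
    have h : ∃ g' : Equiv.Perm (Fin M), g'.partition = g.partition := ⟨g, rfl⟩
    have h1 := congrFun hf g.partition
    simp only [G, LinearMap.pi_apply, dif_pos h] at h1
    have h2 : f.1 (single h.choose 1) = 0 := h1
    have h3 := traceFunctional_single_eq_of_isConj f.2
      (Equiv.Perm.partition_eq_of_isConj.2 h.choose_spec)
    exact h3.symm.trans h2
  have := LinearMap.finrank_le_finrank_of_injective hG
  rwa [Module.finrank_fintype_fun_eq_card, hcard] at this

/-- The functional is a multiple of `x ↦ tr (w ↦ x w c)` with `c` the symmetrizer of `p`; it kills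
commutators because left and right multiplications commute. For `x = c` the operator has rank one
and trace `n²`, where `c² = n c`; for any other symmetrizer it is zero. -/
theorem exists_traceFunctional_youngSymmetrizer (p : M.Partition) :
    ∃ f ∈ traceFunctional M, ∀ q, f (youngSymmetrizer q) = (Pi.single p 1 : M.Partition → ℂ) q := by
  let c := youngSymmetrizer p
  let f : SymAlg M →ₗ[ℂ] ℂ := LinearMap.trace ℂ (SymAlg M) ∘ₗ
    LinearMap.mulRight ℂ (LinearMap.mulRight ℂ c) ∘ₗ LinearMap.mul ℂ (SymAlg M)
  have hf (x : SymAlg M) : f x = LinearMap.trace ℂ (SymAlg M)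
    (LinearMap.mulLeft ℂ x * LinearMap.mulRight ℂ c) := rfl
  have hmem : f ∈ traceFunctional M := by
    intro x y
    have hcomm (z : SymAlg M) : LinearMap.mulLeft ℂ z * LinearMap.mulRight ℂ c =
        LinearMap.mulRight ℂ c * LinearMap.mulLeft ℂ z :=
      LinearMap.ext fun w => mul_assoc z w c |>.symm
    rw [hf, hf, LinearMap.mulLeft_mul, LinearMap.mulLeft_mul, ← Module.End.mul_eq_comp,
      ← Module.End.mul_eq_comp, mul_assoc, hcomm, ← mul_assoc, LinearMap.trace_mul_comm,
      ← mul_assoc]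
  obtain ⟨n, hn⟩ := exists_youngSymmetrizer_mul_mul p 1
  rw [mul_one] at hn
  have hn0 : n ≠ 0 := by
    rintro rfl
    exact youngSymmetrizer_mul_self_ne_zero p (by rw [hn, zero_smul])
  let φ : SymAlg M →ₗ[ℂ] ℂ := Finsupp.lapply 1 ∘ₗ (coeffLinearEquiv ℂ).toLinearMap ∘ₗ
    LinearMap.mulRight ℂ c ∘ₗ LinearMap.mulLeft ℂ c
  have hφ (x : SymAlg M) : φ x = (c * x * c).coeff 1 := rfl
  have hrank : LinearMap.mulLeft ℂ c * LinearMap.mulRight ℂ c = φ.smulRight c := by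
    refine LinearMap.ext fun x => ?_
    obtain ⟨z, hz⟩ := exists_youngSymmetrizer_mul_mul p x
    rw [LinearMap.smulRight_apply, hφ, hz, coeff_smul_apply, coeff_youngSymmetrizer_one]
    simpa [mul_assoc] using hz
  have hfp : f c = n * n := by
    rw [hf, hrank, LinearMap.trace_smulRight, hφ, hn, smul_mul_assoc, hn, coeff_smul_apply,
      coeff_smul_apply, coeff_youngSymmetrizer_one]
    simp
  refine ⟨(n * n)⁻¹ • f, Submodule.smul_mem _ _ hmem, fun q => ?_⟩
  rw [LinearMap.smul_apply]
  by_cases h : q = p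
  · subst h
    rw [hfp, Pi.single_eq_same, smul_eq_mul, inv_mul_cancel₀ (mul_ne_zero hn0 hn0)]
  · rw [Pi.single_eq_of_ne h, hf]
    have : LinearMap.mulLeft ℂ (youngSymmetrizer q) * LinearMap.mulRight ℂ c = 0 :=
      LinearMap.ext fun x => by
        simpa [mul_assoc] using youngSymmetrizer_mul_mul_eq_zero h x
    rw [this, map_zero, smul_zero]

/-- Evaluation at the symmetrizers is surjective onto a space of at least the same dimension, hence
injective. -/
theorem eq_zero_of_forall_youngSymmetrizer {f : SymAlg M →ₗ[ℂ] ℂ} (hf : f ∈ traceFunctional M)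
    (h : ∀ p, f (youngSymmetrizer p) = 0) : f = 0 := by
  let F : traceFunctional M →ₗ[ℂ] (M.Partition → ℂ) := LinearMap.pi fun p =>
    (LinearMap.applyₗ (youngSymmetrizer p)).comp (traceFunctional M).subtype
  have hF : Function.Surjective F := by
    rw [← LinearMap.range_eq_top, eq_top_iff, ← (Pi.basisFun ℂ M.Partition).span_eq,
      Submodule.span_le]
    rintro _ ⟨p, rfl⟩
    obtain ⟨e, he, hep⟩ := exists_traceFunctional_youngSymmetrizer p
    exact ⟨⟨e, he⟩, by ext q; simpa [F] using hep q⟩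
  have hker : Module.finrank ℂ (LinearMap.ker F) = 0 := by
    have h1 := F.finrank_range_add_finrank_ker
    rw [LinearMap.range_eq_top.2 hF, finrank_top, Module.finrank_fintype_fun_eq_card] at h1
    have := finrank_traceFunctional_le (M := M)
    omega
  have hfker : (⟨f, hf⟩ : traceFunctional M) ∈ LinearMap.ker F := funext h
  rw [Submodule.finrank_eq_zero.1 hker, Submodule.mem_bot] at hfker
  exact congrArg Subtype.val hfker

/-- A module over the group algebra on which all Young symmetrizers vanish is trivial. -/
theorem subsingleton_of_youngSymmetrizer_smul {W : Type*} [AddCommGroup W] [Module ℂ W]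
    [Module (SymAlg M) W] [IsScalarTower ℂ (SymAlg M) W] [Module.Finite ℂ W]
    (h : ∀ (p : M.Partition) (w : W), youngSymmetrizer p • w = 0) : Subsingleton W := by
  let A : SymAlg M →ₐ[ℂ] Module.End ℂ W := Algebra.lsmul ℂ ℂ W
  let f : SymAlg M →ₗ[ℂ] ℂ := LinearMap.trace ℂ W ∘ₗ A.toLinearMap
  have hf : f ∈ traceFunctional M := fun x y => by
    simp only [f, LinearMap.comp_apply, AlgHom.toLinearMap_apply, map_mul]
    exact LinearMap.trace_mul_comm _ _ _
  have h0 := eq_zero_of_forall_youngSymmetrizer hf fun p => by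
    have : A (youngSymmetrizer p) = 0 := LinearMap.ext (h p)
    simp [f, this]
  -- The character at `1` is the dimension, which characteristic zero detects.
  have h1 : f 1 = Module.finrank ℂ W := by simp [f]
  rw [h0, LinearMap.zero_apply] at h1
  exact Module.finrank_zero_iff.1 (by exact_mod_cast h1.symm)

end TraceFunctional

/-! ### Specht modules -/

section SpechtModules

variable {M : ℕ}

theorem youngSymmetrizer_mem_Specht (p : M.Partition) : youngSymmetrizer p ∈ Specht p :=
  Submodule.mem_span_singleton_self _

theorem mem_Specht {p : M.Partition} {x : SymAlg M} :
    x ∈ Specht p ↔ ∃ y, y * youngSymmetrizer p = x :=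
  Submodule.mem_span_singleton

theorem youngSymmetrizer_mul_eq_zero_of_mem_Specht {p q : M.Partition} (hpq : p ≠ q) {x : SymAlg M}
    (hx : x ∈ Specht q) : youngSymmetrizer p * x = 0 := by
  obtain ⟨y, rfl⟩ := mem_Specht.1 hx
  rw [← mul_assoc, youngSymmetrizer_mul_mul_eq_zero hpq]

instance isSimpleModule_Specht (p : M.Partition) : IsSimpleModule (SymAlg M) (Specht p) := by
  rw [isSimpleModule_iff_isAtom]
  refine ⟨fun h => youngSymmetrizer_ne_zero p ?_, fun N hN => ?_⟩
  · rw [← Submodule.mem_bot (SymAlg M), ← h]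
    exact youngSymmetrizer_mem_Specht p
  by_contra hN0
  refine hN.not_ge (Submodule.span_le.2 (Set.singleton_subset_iff.2 ?_))
  change youngSymmetrizer p ∈ N
  -- With `e = y c` one gets `c e = c y c = z c`. If `z = 0`, then `e = e² = y c e = 0`; otherwise
  -- `c` lies in `N`.
  obtain ⟨e, he, rfl⟩ := IsSemisimpleRing.ideal_eq_span_idempotent N
  have hmem : e ∈ Ideal.span {e} := Ideal.mem_span_singleton_self e
  obtain ⟨y, hy⟩ := mem_Specht.1 (hN.le hmem)
  obtain ⟨z, hz⟩ := exists_youngSymmetrizer_mul_mul p y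
  have hz' : youngSymmetrizer p * e = z • youngSymmetrizer p := by rw [← hz, mul_assoc, hy]
  have hz0 : z ≠ 0 := by
    rintro rfl
    refine hN0 (Ideal.span_singleton_eq_bot.2 ?_)
    rw [← he.eq]
    nth_rw 1 [← hy]
    rw [mul_assoc, hz', zero_smul, mul_zero]
  have h1 : z⁻¹ • (youngSymmetrizer p * e) ∈ Ideal.span {e} := by
    rw [← smul_mul_assoc]
    exact Ideal.mul_mem_left _ _ hmem
  rwa [hz', inv_smul_smul₀ hz0] at h1

variable {V : Type*} [AddCommGroup V] [Module (SymAlg M) V]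

theorem youngSymmetrizer_smul_mem_isotypicComponent (p : M.Partition) (v : V) :
    youngSymmetrizer p • v ∈ isotypicComponent (SymAlg M) V (Specht p) := by
  let f : Specht p →ₗ[SymAlg M] V :=
    (LinearMap.toSpanSingleton (SymAlg M) V v).comp (Specht p).subtype
  have hmem : youngSymmetrizer p • v ∈ LinearMap.range f :=
    ⟨⟨_, youngSymmetrizer_mem_Specht p⟩, rfl⟩
  rcases f.injective_or_eq_zero with hf | hf
  · have h : LinearMap.range f ≤ isotypicComponent (SymAlg M) V (Specht p) :=
      le_sSup ⟨(LinearEquiv.ofInjective f hf).symm⟩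
    exact h hmem
  · rw [hf, LinearMap.range_zero, Submodule.mem_bot] at hmem
    rw [hmem]
    exact zero_mem _

theorem youngSymmetrizer_smul_eq_zero_of_mem_isotypicComponent {p q : M.Partition} (hpq : p ≠ q)
    {v : V} (hv : v ∈ isotypicComponent (SymAlg M) V (Specht q)) : youngSymmetrizer p • v = 0 := by
  rw [isotypicComponent, sSup_eq_iSup'] at hv
  induction hv using Submodule.iSup_induction' with
  | mem m x hx =>
    obtain ⟨e⟩ := m.2
    have h : youngSymmetrizer p • (⟨x, hx⟩ : m.1) = 0 := by
      apply e.injective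
      rw [map_smul, map_zero]
      exact Subtype.ext (youngSymmetrizer_mul_eq_zero_of_mem_Specht hpq (e ⟨x, hx⟩).2)
    exact congrArg Subtype.val h
  | zero => exact smul_zero _
  | add x y _ _ hx hy => rw [smul_add, hx, hy, add_zero]

variable [Module ℂ V] [IsScalarTower ℂ (SymAlg M) V] [Module.Finite ℂ V]

theorem eq_bot_of_youngSymmetrizer_smul {W : Submodule (SymAlg M) V}
    (h : ∀ (p : M.Partition), ∀ w ∈ W, youngSymmetrizer p • w = 0) : W = ⊥ := by
  have : Module.Finite ℂ W := inferInstanceAs (Module.Finite ℂ (W.restrictScalars ℂ))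
  have : Subsingleton W := subsingleton_of_youngSymmetrizer_smul fun p w =>
    Subtype.ext (h p w w.2)
  exact W.subsingleton_iff_eq_bot.1 this

/-- Every symmetrizer kills the intersection, since each `r` differs from `p` or from `q`. -/
theorem disjoint_isotypicComponent_Specht {p q : M.Partition} (hpq : p ≠ q) :
    Disjoint (isotypicComponent (SymAlg M) V (Specht p))
      (isotypicComponent (SymAlg M) V (Specht q)) := by
  rw [disjoint_iff]
  refine eq_bot_of_youngSymmetrizer_smul fun r w hw => ?_
  by_cases hr : r = p
  · exact youngSymmetrizer_smul_eq_zero_of_mem_isotypicComponent (hr ▸ hpq) hw.2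
  · exact youngSymmetrizer_smul_eq_zero_of_mem_isotypicComponent hr hw.1

/-- A symmetrizer maps a complement into the sum of the components as well as into itself, hence to
zero; so the complement is trivial. -/
theorem iSup_isotypicComponent_Specht :
    ⨆ p : M.Partition, isotypicComponent (SymAlg M) V (Specht p) = ⊤ := by
  obtain ⟨W, hW⟩ := exists_isCompl (⨆ p : M.Partition, isotypicComponent (SymAlg M) V (Specht p))
  have h0 : W = ⊥ := eq_bot_of_youngSymmetrizer_smul fun p w hw => by
    rw [← Submodule.mem_bot (SymAlg M), ← hW.inf_eq_bot]
    exact ⟨le_iSup (fun p : M.Partition => isotypicComponent (SymAlg M) V (Specht p)) p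
      (youngSymmetrizer_smul_mem_isotypicComponent p w), W.smul_mem _ hw⟩
  rw [← hW.sup_eq_top, h0, sup_bot_eq]

end SpechtModules

/-! ### The Schur-Weyl blocks -/

section Blocks

variable {d M : ℕ}

/-- Permutation of the positions of a multi-index. -/
def permIndex (d : ℕ) {M : ℕ} (g : Equiv.Perm (Fin M)) : (Fin M → Fin d) ≃ (Fin M → Fin d) where
  toFun i := i ∘ g
  invFun i := i ∘ ⇑g⁻¹
  left_inv i := by ext; simp
  right_inv i := by ext; simp

theorem permRep_apply (g : Equiv.Perm (Fin M)) (v : TensorSpace d M) (i : Fin M → Fin d) :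
    permRep d M g v i = v (i ∘ g) := rfl

theorem inner_permRep_left (g : Equiv.Perm (Fin M)) (v w : TensorSpace d M) :
    inner ℂ (permRep d M g v) w = inner ℂ v (permRep d M g⁻¹ w) := by
  rw [PiLp.inner_apply, PiLp.inner_apply,
    ← (permIndex d g).sum_comp fun i => inner ℂ (v i) (permRep d M g⁻¹ w i)]
  refine Finset.sum_congr rfl fun i _ => ?_
  rw [permRep_apply, permRep_apply]
  have : (permIndex d g i) ∘ ⇑g⁻¹ = i := (permIndex d g).left_inv i
  rw [this]
  rfl

/-- A linear map that commutes with the permutations of the tensor factors, as a map of modules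
over the group algebra. -/
def equivariantEnd (A : TensorSpace d M →ₗ[ℂ] TensorSpace d M)
    (hA : ∀ g v, A (permRep d M g v) = permRep d M g (A v)) :
    (permRep d M).asModule →ₗ[SymAlg M] (permRep d M).asModule :=
  MonoidAlgebra.equivariantOfLinearOfComm
    ((permRep d M).asModuleEquiv.symm.toLinearMap ∘ₗ A ∘ₗ (permRep d M).asModuleEquiv.toLinearMap)
    fun g v => by
      rw [Representation.single_smul, Representation.single_smul, one_smul, one_smul]
      exact hA g v

theorem mem_schurBlock {p : M.Partition} {v : TensorSpace d M} :
    v ∈ schurBlock d p ↔ (permRep d M).asModuleEquiv.symm v ∈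
      isotypicComponent (SymAlg M) (permRep d M).asModule (Specht p) :=
  Submodule.mem_map_equiv (e := (permRep d M).asModuleEquiv) _

theorem map_mem_schurBlock {A : TensorSpace d M →ₗ[ℂ] TensorSpace d M}
    (hA : ∀ g v, A (permRep d M g v) = permRep d M g (A v)) {p : M.Partition} {v : TensorSpace d M}
    (hv : v ∈ schurBlock d p) : A v ∈ schurBlock d p :=
  mem_schurBlock.2 ((equivariantEnd A hA).le_comap_isotypicComponent (Specht p)
    (mem_schurBlock.1 hv))

theorem permRep_mem_schurBlock (g : Equiv.Perm (Fin M)) {p : M.Partition} {v : TensorSpace d M}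
    (hv : v ∈ schurBlock d p) : permRep d M g v ∈ schurBlock d p := by
  rw [mem_schurBlock, Representation.asModuleEquiv_symm_map_rho]
  exact Submodule.smul_mem _ _ (mem_schurBlock.1 hv)

theorem starProjection_schurBlock_permRep (p : M.Partition) (g : Equiv.Perm (Fin M))
    (v : TensorSpace d M) : (schurBlock d p).starProjection (permRep d M g v) =
      permRep d M g ((schurBlock d p).starProjection v) := by
  refine (Submodule.eq_starProjection_of_mem_of_inner_eq_zero (K := schurBlock d p)
    (permRep_mem_schurBlock g (Submodule.starProjection_apply_mem _ v)) fun w hw => ?_)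
  rw [← map_sub, inner_permRep_left]
  exact Submodule.starProjection_inner_eq_zero _ _ (permRep_mem_schurBlock g⁻¹ hw)

/-- The projection onto the `q`-block is equivariant, so it maps the `p`-block into itself as well
as into the `q`-block, and these are disjoint. -/
theorem isOrtho_schurBlock {p q : M.Partition} (hpq : p ≠ q) :
    schurBlock d p ⟂ schurBlock d q := by
  refine Submodule.IsOrtho.symm ?_
  rw [← Submodule.starProjection_comp_starProjection_eq_zero_iff]
  ext1 v
  have hv : (schurBlock d p).starProjection v ∈ schurBlock d p :=
    Submodule.starProjection_apply_mem _ v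
  have h := map_mem_schurBlock (A := (schurBlock d q).starProjection.toLinearMap)
    (starProjection_schurBlock_permRep q) hv
  have h' : (schurBlock d q).starProjection ((schurBlock d p).starProjection v) ∈ schurBlock d q :=
    Submodule.starProjection_apply_mem _ _
  have := (disjoint_isotypicComponent_Specht hpq).le_bot ⟨mem_schurBlock.1 h, mem_schurBlock.1 h'⟩
  rw [Submodule.mem_bot, LinearEquiv.map_eq_zero_iff] at this
  exact this

theorem iSup_schurBlock : ⨆ p : M.Partition, schurBlock d p = ⊤ := by
  refine eq_top_iff.2 fun v _ => ?_
  have hv : (permRep d M).asModuleEquiv.symm v ∈ ⨆ p : M.Partition,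
      isotypicComponent (SymAlg M) (permRep d M).asModule (Specht p) := by
    rw [iSup_isotypicComponent_Specht]; trivial
  obtain ⟨w, rfl⟩ := (permRep d M).asModuleEquiv.surjective v
  rw [LinearEquiv.symm_apply_apply] at hv
  induction hv using Submodule.iSup_induction' with
  | mem p x hx =>
    exact Submodule.mem_iSup_of_mem p (mem_schurBlock.2 (by rwa [LinearEquiv.symm_apply_apply]))
  | zero => exact zero_mem _
  | add x y _ _ hx hy => rw [map_add]; exact add_mem (hx trivial) (hy trivial)

theorem sum_starProjection_schurBlock (v : TensorSpace d M) :
    ∑ p : M.Partition, (schurBlock d p).starProjection v = v :=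
  (OrthogonalFamily.of_pairwise fun _ _ h => isOrtho_schurBlock h).sum_projection_of_mem_iSup v
    (by rw [iSup_schurBlock]; trivial)

set_option synthInstance.maxHeartbeats 200000 in
theorem isProjectiveMeasurement_schurProj (d M : ℕ) :
    IsProjectiveMeasurement (fun p : M.Partition => (schurProj d p : TensorOp d M)) where
  isStarProjection p := isStarProjection_starProjection.map
    (Matrix.toEuclideanCLM (n := Fin M → Fin d) (𝕜 := ℂ)).symm
  orthogonal p q hpq := by
    rw [schurProj, schurProj, ← map_mul, ContinuousLinearMap.mul_def,
      (isOrtho_schurBlock hpq).starProjection_comp_starProjection, map_zero]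
  sum_eq_one := by
    simp only [schurProj]
    rw [← map_sum, ← map_one (Matrix.toEuclideanCLM (n := Fin M → Fin d) (𝕜 := ℂ)).symm]
    congr 1
    ext1 v
    simpa using sum_starProjection_schurBlock v

theorem posSemidef_schurProj (p : M.Partition) : (schurProj d p).PosSemidef := by
  have h := (isProjectiveMeasurement_schurProj d M).isStarProjection p
  rw [← h.isIdempotentElem.eq]
  nth_rw 1 [← h.isSelfAdjoint.star_eq]
  exact Matrix.posSemidef_conjTranspose_mul_self _

theorem posSemidef_wssTest {c : M.Partition → ℝ} (hc : ∀ p, 0 ≤ c p) :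
    (wssTest d c).PosSemidef :=
  Matrix.posSemidef_sum _ fun p _ => (posSemidef_schurProj p).smul (by exact_mod_cast hc p)

theorem isTest_wssTest {c : M.Partition → ℝ} (hc : ∀ p, 0 ≤ c p ∧ c p ≤ 1) :
    IsTest (wssTest d c) := by
  refine ⟨posSemidef_wssTest fun p => (hc p).1, ?_⟩
  have : 1 - wssTest d c = wssTest d fun p => 1 - c p := by
    rw [← (isProjectiveMeasurement_schurProj d M).sum_eq_one, wssTest, wssTest,
      ← Finset.sum_sub_distrib]
    exact Finset.sum_congr rfl fun p _ => by rw [Complex.ofReal_sub, sub_smul]; simp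
  rw [this]
  exact posSemidef_wssTest fun p => sub_nonneg.2 (hc p).2

end Blocks

/-! ### Central endomorphisms -/

section Central

variable {M : ℕ}

/-- Schur's lemma made explicit: with `c² = n c` and `φ c = y c`, one has `n φ(c) = φ(c c) = c y c =
z c`, and `c` generates. -/
theorem exists_forall_Specht_end_eq_smul {p : M.Partition}
    (φ : Specht p →ₗ[SymAlg M] Specht p) : ∃ μ : ℂ, ∀ x, φ x = μ • x := by
  let c : Specht p := ⟨youngSymmetrizer p, youngSymmetrizer_mem_Specht p⟩
  have hspan (x : Specht p) : ∃ y : SymAlg M, x = y • c := by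
    obtain ⟨y, hy⟩ := mem_Specht.1 x.2
    exact ⟨y, Subtype.ext hy.symm⟩
  obtain ⟨n, hn⟩ := exists_youngSymmetrizer_mul_mul p 1
  rw [mul_one] at hn
  have hn0 : n ≠ 0 := by
    rintro rfl
    exact youngSymmetrizer_mul_self_ne_zero p (by rw [hn, zero_smul])
  obtain ⟨y, hy⟩ := hspan (φ c)
  obtain ⟨z, hz⟩ := exists_youngSymmetrizer_mul_mul p y
  have h1 : n • φ c = z • c := by
    have hcc : n • c = youngSymmetrizer p • c := Subtype.ext hn.symm
    have hcy : youngSymmetrizer p • y • c = z • c := Subtype.ext ((mul_assoc _ _ _).symm.trans hz)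
    have : n • φ c = φ (n • c) := by
      rw [← smul_one_smul (SymAlg M) n (φ c), ← smul_one_smul (SymAlg M) n c, map_smul]
    rw [this, hcc, map_smul, hy, hcy]
  have h2 : φ c = (n⁻¹ * z) • c := by rw [mul_smul, ← h1, inv_smul_smul₀ hn0]
  refine ⟨n⁻¹ * z, fun x => ?_⟩
  obtain ⟨w, rfl⟩ := hspan x
  rw [map_smul, h2, smul_comm]

theorem exists_forall_mem_isotypicComponent_eq_smul {V : Type*} [AddCommGroup V]
    [Module (SymAlg M) V] [Module ℂ V] [IsScalarTower ℂ (SymAlg M) V] (τ : Module.End (SymAlg M) V)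
    (hτ : ∀ X : Module.End (SymAlg M) V, Commute τ X) (p : M.Partition) :
    ∃ μ : ℂ, ∀ v ∈ isotypicComponent (SymAlg M) V (Specht p), τ v = μ • v := by
  by_cases hne : ∃ m : Submodule (SymAlg M) V, Nonempty (m ≃ₗ[SymAlg M] Specht p)
  · obtain ⟨m₀, ⟨e₀⟩⟩ := hne
    let i : Specht p →ₗ[SymAlg M] V := m₀.subtype ∘ₗ e₀.symm.toLinearMap
    have hi : Function.Injective i := m₀.injective_subtype.comp e₀.symm.injective
    -- The scalar is read off on one copy of the Specht module, through a retraction `r`. Any other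
    -- copy is reached by an endomorphism `X` of `V`, with which `τ` commutes, so the scalar is the
    -- same there.
    obtain ⟨r, hr⟩ := IsSemisimpleModule.extension_property i hi LinearMap.id
    obtain ⟨μ, hμ⟩ := exists_forall_Specht_end_eq_smul (r ∘ₗ τ ∘ₗ i)
    refine ⟨μ, fun v hv => ?_⟩
    rw [isotypicComponent, sSup_eq_iSup'] at hv
    induction hv using Submodule.iSup_induction' with
    | mem m x hx =>
      obtain ⟨e⟩ := m.2
      let X : Module.End (SymAlg M) V := m.1.subtype ∘ₗ e.symm.toLinearMap ∘ₗ r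
      have hX : X (i (e ⟨x, hx⟩)) = x := by
        have : r (i (e ⟨x, hx⟩)) = e ⟨x, hx⟩ := LinearMap.congr_fun hr _
        simp [X, this]
      have h1 : τ x = X (τ (i (e ⟨x, hx⟩))) := by
        conv_lhs => rw [← hX]
        exact LinearMap.congr_fun (hτ X) _
      have h2 : r (τ (i (e ⟨x, hx⟩))) = μ • e ⟨x, hx⟩ := hμ _
      have h3 : e.symm (μ • e ⟨x, hx⟩) = μ • (⟨x, hx⟩ : m.1) := by
        rw [← smul_one_smul (SymAlg M) μ (e ⟨x, hx⟩), map_smul, e.symm_apply_apply,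
          smul_one_smul]
      rw [h1]
      simp only [X, LinearMap.comp_apply, h2, LinearEquiv.coe_coe, h3]
      rfl
    | zero => rw [map_zero, smul_zero]
    | add x y _ _ hx hy => rw [map_add, hx, hy, smul_add]
  · have : isotypicComponent (SymAlg M) V (Specht p) = ⊥ :=
      sSup_eq_bot.2 fun m hm => (hne ⟨m, hm⟩).elim
    refine ⟨0, fun v hv => ?_⟩
    rw [this, Submodule.mem_bot] at hv
    rw [hv, map_zero, smul_zero]

end Central

/-! ### The commutant of the tensor powers of the unitaries -/

section Commutant

variable {d M : ℕ}

theorem tensorPower_mul (A B : Op d) :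
    tensorPower M (A * B) = tensorPower M A * tensorPower M B := by
  ext i j
  simp only [tensorPower, Matrix.of_apply, Matrix.mul_apply, Finset.prod_univ_sum,
    Fintype.piFinset_univ, Finset.prod_mul_distrib]

theorem tensorPower_one : tensorPower M (1 : Op d) = 1 := by
  ext i j
  simp only [tensorPower, Matrix.of_apply, Matrix.one_apply, Finset.prod_ite_zero,
    Finset.prod_const_one, Finset.mem_univ, forall_const, funext_iff]

theorem tensorPower_conjTranspose (A : Op d) : tensorPower M Aᴴ = (tensorPower M A)ᴴ := by
  ext i j
  simp [tensorPower, Matrix.conjTranspose_apply]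

theorem tensorPower_diagonal (z : Fin d → ℂ) :
    tensorPower M (Matrix.diagonal z) = Matrix.diagonal fun i => ∏ k, z (i k) := by
  ext i j
  simp only [tensorPower, Matrix.of_apply, Matrix.diagonal_apply, Finset.prod_ite_zero,
    Finset.mem_univ, forall_const, funext_iff]

theorem prod_comp_eq_prod_pow (z : Fin d → ℂ) (i : Fin M → Fin d) :
    ∏ k, z (i k) = ∏ a, z a ^ (Finset.univ.filter fun k => i k = a).card := by
  rw [← Finset.prod_fiberwise Finset.univ i]
  refine Finset.prod_congr rfl fun a _ => ?_
  rw [← Finset.prod_const]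
  exact Finset.prod_congr rfl fun k hk => by rw [(Finset.mem_filter.1 hk).2]

theorem commute_diagonal_iff {ι : Type*} [Fintype ι] [DecidableEq ι] {T : Matrix ι ι ℂ}
    {z : ι → ℂ} : Commute T (Matrix.diagonal z) ↔ ∀ i j, T i j ≠ 0 → z i = z j := by
  constructor
  · intro h i j hij
    have := congrFun (congrFun h.eq i) j
    rw [Matrix.mul_diagonal, Matrix.diagonal_mul, mul_comm] at this
    exact (mul_right_cancel₀ hij this).symm
  · intro h
    ext i j
    rw [Matrix.mul_diagonal, Matrix.diagonal_mul]
    by_cases hij : T i j = 0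
    · simp [hij]
    · rw [h i j hij, mul_comm]

theorem card_fiber_eq_of_commute_unitary {T : TensorOp d M}
    (hT : ∀ U ∈ Matrix.unitaryGroup (Fin d) ℂ, Commute T (tensorPower M U))
    {i j : Fin M → Fin d} (hij : T i j ≠ 0) (a : Fin d) :
    (Finset.univ.filter fun k => i k = a).card = (Finset.univ.filter fun k => j k = a).card := by
  -- Fiber sizes are at most `M`, so a root of unity of order `M + 1` tells them apart.
  have hζ := Complex.isPrimitiveRoot_exp (M + 1) M.succ_ne_zero
  set ζ := Complex.exp (2 * Real.pi * Complex.I / (M + 1 : ℕ))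
  let z : Fin d → ℂ := fun b => if b = a then ζ else 1
  have hz : Matrix.diagonal z ∈ Matrix.unitaryGroup (Fin d) ℂ := by
    rw [Matrix.mem_unitaryGroup_iff, Matrix.star_eq_conjTranspose, Matrix.diagonal_conjTranspose,
      Matrix.diagonal_mul_diagonal, ← Matrix.diagonal_one]
    congr 1
    ext b
    have : ζ * star ζ = 1 := by
      rw [← starRingEnd_apply, Complex.mul_conj, Complex.normSq_eq_norm_sq,
        hζ.norm'_eq_one M.succ_ne_zero]
      simp
    by_cases hb : b = a <;> simp [z, hb]
    simpa using this
  have h := hT _ hz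
  rw [tensorPower_diagonal, commute_diagonal_iff] at h
  have h1 := h i j hij
  have hprod (l : Fin M → Fin d) :
      ∏ k, z (l k) = ζ ^ (Finset.univ.filter fun k => l k = a).card := by
    rw [← Finset.prod_const, Finset.prod_filter]
  rw [hprod, hprod] at h1
  have hlt (l : Fin M → Fin d) : (Finset.univ.filter fun k => l k = a).card < M + 1 :=
    Nat.lt_succ_of_le ((Finset.card_le_univ _).trans_eq (Fintype.card_fin M))
  exact hζ.pow_inj (hlt i) (hlt j) h1

/-- The diagonal entries of the tensor power depend only on fiber sizes, which agree wherever `T`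
has a nonzero entry. This passes from unitary to arbitrary diagonal matrices. -/
theorem commute_tensorPower_diagonal {T : TensorOp d M}
    (hT : ∀ U ∈ Matrix.unitaryGroup (Fin d) ℂ, Commute T (tensorPower M U))
    (z : Fin d → ℂ) :
    Commute T (tensorPower M (Matrix.diagonal z)) := by
  rw [tensorPower_diagonal, commute_diagonal_iff]
  intro i j hij
  rw [prod_comp_eq_prod_pow, prod_comp_eq_prod_pow]
  simp only [card_fiber_eq_of_commute_unitary hT hij]

theorem commute_tensorPower_of_isHermitian {T : TensorOp d M}
    (hT : ∀ U ∈ Matrix.unitaryGroup (Fin d) ℂ, Commute T (tensorPower M U))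
    {A : Op d} (hA : A.IsHermitian) :
    Commute T (tensorPower M A) := by
  rw [hA.spectral_theorem, Unitary.conjStarAlgAut_apply, tensorPower_mul, tensorPower_mul]
  exact ((hT _ hA.eigenvectorUnitary.2).mul_right (commute_tensorPower_diagonal hT _)).mul_right
    (hT _ (star hA.eigenvectorUnitary).2)

theorem commute_tensorPower {T : TensorOp d M}
    (hT : ∀ U ∈ Matrix.unitaryGroup (Fin d) ℂ, Commute T (tensorPower M U))
    (A : Op d) : Commute T (tensorPower M A) := by
  obtain ⟨H, K, hH, hK, rfl⟩ : ∃ H K : Op d, H.IsHermitian ∧ K.IsHermitian ∧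
      A = H + Complex.I • K :=
    ⟨realPart A, imaginaryPart A, (realPart A).2, (imaginaryPart A).2,
      (realPart_add_I_smul_imaginaryPart A).symm⟩
  ext i j
  let e (l m : Fin M → Fin d) : Polynomial ℂ :=
    ∏ k, (Polynomial.C (H (l k) (m k)) + Polynomial.X * Polynomial.C (K (l k) (m k)))
  have he (l m : Fin M → Fin d) (t : ℂ) : (e l m).eval t = tensorPower M (H + t • K) l m := by
    simp [e, Polynomial.eval_prod, tensorPower, mul_comm t]
  -- An entry of the commutator of `T` with `(H + tK)^{⊗M}`, as a polynomial in `t`. It vanishes for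
  -- real `t`, where `H + tK` is Hermitian, hence also at `t = I`.
  let P : Polynomial ℂ := ∑ l, Polynomial.C (T i l) * e l j - ∑ l, e i l * Polynomial.C (T l j)
  have hP (t : ℂ) : P.eval t =
      (T * tensorPower M (H + t • K)) i j - (tensorPower M (H + t • K) * T) i j := by
    simp [P, Polynomial.eval_finsetSum, he, Matrix.mul_apply]
  have hP0 : P = 0 := by
    refine Polynomial.eq_zero_of_infinite_isRoot P
      ((Set.infinite_range_of_injective Complex.ofReal_injective).mono ?_)
    rintro _ ⟨t, rfl⟩
    have hHK : (H + (t : ℂ) • K).IsHermitian := hH.add (hK.smul (by simp [isSelfAdjoint_iff]))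
    change P.eval _ = 0
    rw [hP, (commute_tensorPower_of_isHermitian hT hHK).eq, sub_self]
  have := hP Complex.I
  rw [hP0, Polynomial.eval_zero] at this
  exact (sub_eq_zero.1 this.symm)

/-- Ryser's formula for the permanent. -/
theorem sum_perm_prod_eq_ryser {R ι : Type*} [CommRing R] [Fintype ι] [DecidableEq ι]
    (a : ι → ι → R) : ∑ g : Equiv.Perm ι, ∏ n, a (g n) n =
      ∑ S : Finset ι, (-1) ^ S.card * ∏ n, ∑ k ∈ Sᶜ, a k n := by
  have h1 (S : Finset ι) : ∏ n, ∑ k ∈ Sᶜ, a k n =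
      ∑ φ : ι → ι, if S ⊆ (Finset.univ.image φ)ᶜ then ∏ n, a (φ n) n else 0 := by
    rw [Finset.prod_univ_sum, ← Finset.sum_filter]
    refine Finset.sum_congr (Finset.ext fun φ => ?_) fun _ _ => rfl
    simp only [Fintype.mem_piFinset, Finset.mem_compl, Finset.mem_filter, Finset.mem_univ, true_and,
      Finset.subset_iff, Finset.mem_image]
    exact ⟨fun h x hx ⟨n, hn⟩ => h n (hn ▸ hx), fun h n hn => h hn ⟨n, rfl⟩⟩
  simp only [h1, Finset.mul_sum]
  rw [Finset.sum_comm]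
  -- Inclusion-exclusion: the alternating sum over subsets of the complement of the image vanishes
  -- unless that complement is empty.
  have h2 (φ : ι → ι) : (∑ S : Finset ι, (-1 : R) ^ S.card *
      if S ⊆ (Finset.univ.image φ)ᶜ then ∏ n, a (φ n) n else 0) =
      if Function.Surjective φ then ∏ n, a (φ n) n else 0 := by
    simp only [mul_ite, mul_zero]
    rw [← Finset.sum_filter, ← Finset.sum_mul]
    have h3 : (Finset.univ.filter fun S : Finset ι => S ⊆ (Finset.univ.image φ)ᶜ) =
        ((Finset.univ.image φ)ᶜ).powerset := by ext; simp
    have h4 : (Finset.univ.image φ)ᶜ = ∅ ↔ Function.Surjective φ := by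
      rw [Finset.compl_eq_empty_iff, Finset.eq_univ_iff_forall]
      simp [Function.Surjective]
    have h5 := congrArg (Int.cast : ℤ → R)
      (Finset.sum_powerset_neg_one_pow_card (x := (Finset.univ.image φ)ᶜ))
    push_cast at h5
    rw [h3, h5]
    simp only [h4]
    split_ifs <;> simp
  simp only [h2]
  rw [← Finset.sum_filter]
  refine Finset.sum_bij (fun g _ => ⇑g) (fun g _ => by simpa using g.surjective)
    (fun g _ h _ hgh => DFunLike.coe_injective hgh) (fun φ hφ => ?_) fun _ _ => rfl
  exact ⟨Equiv.ofBijective φ (Finite.surjective_iff_bijective.1 (Finset.mem_filter.1 hφ).2),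
    Finset.mem_univ _, rfl⟩

/-- An operator that commutes with `U^{⊗M}` for all unitaries `U` commutes with all operators
that are invariant under permutations of the tensor factors. -/
theorem commute_of_permInvariant {T : TensorOp d M}
    (hT : ∀ U ∈ Matrix.unitaryGroup (Fin d) ℂ, Commute T (tensorPower M U))
    {X : TensorOp d M}
    (hX : ∀ (g : Equiv.Perm (Fin M)) i j, X (i ∘ g) (j ∘ g) = X i j) : Commute T X := by
  -- Polarization: by Ryser's formula this signed sum of tensor powers is the symmetrization of the
  -- matrix unit at `(i, j)`, and such symmetrizations span the invariant operators.
  let Q (i j : Fin M → Fin d) : TensorOp d M := ∑ S : Finset (Fin M), (-1 : ℂ) ^ S.card •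
    tensorPower M (∑ k ∈ Sᶜ, Matrix.single (i k) (j k) 1)
  have hQ (i j l m : Fin M → Fin d) : Q i j l m =
      ∑ g : Equiv.Perm (Fin M), if i ∘ g = l ∧ j ∘ g = m then 1 else 0 := by
    have := (sum_perm_prod_eq_ryser fun k n =>
      (Matrix.single (i k) (j k) (1 : ℂ) : Op d) (l n) (m n)).symm
    simp only [Q, Matrix.sum_apply, Matrix.smul_apply, smul_eq_mul, tensorPower, Matrix.of_apply]
    rw [this]
    refine Finset.sum_congr rfl fun g _ => ?_
    simp only [Matrix.single_apply, Finset.prod_ite_zero, Finset.prod_const_one, Finset.mem_univ,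
      forall_const, funext_iff, Function.comp_apply, forall_and]
  have hX' : (M.factorial : ℂ) • X = ∑ i, ∑ j, X i j • Q i j := by
    ext l m
    simp only [Matrix.sum_apply, Matrix.smul_apply, smul_eq_mul, hQ, Finset.mul_sum, mul_ite,
      mul_one, mul_zero]
    have h1 (g : Equiv.Perm (Fin M)) :
        (∑ i, ∑ j, if i ∘ g = l ∧ j ∘ g = m then X i j else 0) = X l m := by
      have h2 (i n : Fin M → Fin d) : i ∘ g = n ↔ i = n ∘ ⇑g⁻¹ := (permIndex d g).eq_symm_apply.symm
      simp only [h2]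
      rw [Finset.sum_eq_single (l ∘ ⇑g⁻¹), Finset.sum_eq_single (m ∘ ⇑g⁻¹), if_pos ⟨rfl, rfl⟩, hX]
      · exact fun j _ hj => if_neg fun h => hj h.2
      · simp
      · exact fun i _ hi => Finset.sum_eq_zero fun j _ => if_neg fun h => hi h.1
      · simp
    calc
      _ = ∑ _g : Equiv.Perm (Fin M), X l m := by simp [Fintype.card_perm]
      _ = ∑ g : Equiv.Perm (Fin M), ∑ i, ∑ j, if i ∘ g = l ∧ j ∘ g = m then X i j else 0 := by
        simp only [h1]
      _ = _ := by
        rw [Finset.sum_comm]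
        exact Finset.sum_congr rfl fun i _ => Finset.sum_comm
  have hc : Commute T ((M.factorial : ℂ) • X) := by
    rw [hX']
    refine Commute.sum_right _ _ _ fun i _ => Commute.sum_right _ _ _ fun j _ =>
      Commute.smul_right (Commute.sum_right _ _ _ fun S _ => ?_) _
    exact Commute.smul_right (commute_tensorPower hT _) _
  have := hc.smul_right (M.factorial : ℂ)⁻¹
  rwa [inv_smul_smul₀ (by exact_mod_cast M.factorial_ne_zero)] at this

end Commutant

/-! ### Invariant tests -/

section InvariantTests

variable {d M : ℕ}

theorem toEuclideanCLM_permRep {T : TensorOp d M}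
    (hT : ∀ (g : Equiv.Perm (Fin M)) i j, T (i ∘ g) (j ∘ g) = T i j) (g : Equiv.Perm (Fin M))
    (v : TensorSpace d M) :
    Matrix.toEuclideanCLM (n := Fin M → Fin d) (𝕜 := ℂ) T (permRep d M g v) =
      permRep d M g (Matrix.toEuclideanCLM (n := Fin M → Fin d) (𝕜 := ℂ) T v) := by
  ext i
  rw [permRep_apply, Matrix.ofLp_toEuclideanCLM, Matrix.ofLp_toEuclideanCLM, Matrix.mulVec,
    Matrix.mulVec, dotProduct, dotProduct, ← (permIndex d g).sum_comp fun j => T (i ∘ g) j * v j]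
  refine Finset.sum_congr rfl fun j _ => ?_
  change T i j * v (j ∘ g) = T (i ∘ g) (j ∘ g) * v (j ∘ g)
  rw [hT]

theorem toEuclideanCLM_symm_permInvariant {A : TensorSpace d M →L[ℂ] TensorSpace d M}
    (hA : ∀ g v, A (permRep d M g v) = permRep d M g (A v)) (g : Equiv.Perm (Fin M))
    (i j : Fin M → Fin d) :
    (Matrix.toEuclideanCLM (n := Fin M → Fin d) (𝕜 := ℂ)).symm A (i ∘ g) (j ∘ g) =
      (Matrix.toEuclideanCLM (n := Fin M → Fin d) (𝕜 := ℂ)).symm A i j := by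
  obtain ⟨X, rfl⟩ : ∃ X, Matrix.toEuclideanCLM (n := Fin M → Fin d) (𝕜 := ℂ) X = A :=
    ⟨_, StarAlgEquiv.apply_symm_apply _ A⟩
  rw [StarAlgEquiv.symm_apply_apply]
  have hentry (l m : Fin M → Fin d) : X l m =
      Matrix.toEuclideanCLM (n := Fin M → Fin d) (𝕜 := ℂ) X (EuclideanSpace.single m 1) l := by
    simp [EuclideanSpace.single]
  have hsingle : permRep d M g (EuclideanSpace.single (j ∘ g) 1) = EuclideanSpace.single j 1 := by
    ext l
    have : l ∘ g = j ∘ g ↔ l = j := (permIndex d g).apply_eq_iff_eq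
    simp [permRep_apply, this]
  rw [hentry, hentry, ← hsingle, hA, permRep_apply]

/-- An operator that commutes with the tensor powers of all unitaries and with all permutations
of the tensor factors is a scalar on each block. -/
theorem exists_forall_mem_schurBlock_eq_smul {T : TensorOp d M}
    (hU : ∀ U ∈ Matrix.unitaryGroup (Fin d) ℂ, Commute T (tensorPower M U))
    (hT : ∀ (g : Equiv.Perm (Fin M)) i j, T (i ∘ g) (j ∘ g) = T i j) (p : M.Partition) :
    ∃ μ : ℂ, ∀ v ∈ schurBlock d p,
      Matrix.toEuclideanCLM (n := Fin M → Fin d) (𝕜 := ℂ) T v = μ • v := by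
  let e := (permRep d M).asModuleEquiv
  let τ : Module.End (SymAlg M) (permRep d M).asModule :=
    equivariantEnd (Matrix.toEuclideanCLM (n := Fin M → Fin d) (𝕜 := ℂ) T).toLinearMap
      (toEuclideanCLM_permRep hT)
  -- A module endomorphism is a permutation-invariant matrix, so the duality statement makes `τ`
  -- central.
  have hτ (X : Module.End (SymAlg M) (permRep d M).asModule) : Commute τ X := by
    let A : TensorSpace d M →L[ℂ] TensorSpace d M := LinearMap.toContinuousLinearMap
      (e.toLinearMap ∘ₗ X.restrictScalars ℂ ∘ₗ e.symm.toLinearMap)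
    have hA (g : Equiv.Perm (Fin M)) (v : TensorSpace d M) :
        A (permRep d M g v) = permRep d M g (A v) := by
      change e (X (e.symm (permRep d M g v))) = permRep d M g (e (X (e.symm v)))
      rw [Representation.asModuleEquiv_symm_map_rho, map_smul,
        Representation.asModuleEquiv_map_smul, Representation.asAlgebraHom_of]
    have h := (commute_of_permInvariant hU (toEuclideanCLM_symm_permInvariant hA)).map
      (Matrix.toEuclideanCLM (n := Fin M → Fin d) (𝕜 := ℂ))
    rw [StarAlgEquiv.apply_symm_apply] at h
    exact LinearMap.ext fun v => e.injective (congrArg (fun B => B (e v)) h.eq)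
  obtain ⟨μ, hμ⟩ := exists_forall_mem_isotypicComponent_eq_smul τ hτ p
  exact ⟨μ, fun v hv => hμ _ (mem_schurBlock.1 hv)⟩

theorem nonneg_of_posSemidef_of_mulVec_eq_smul {ι : Type*} [Fintype ι] {A : Matrix ι ι ℂ}
    (hA : A.PosSemidef) {μ : ℂ} {v : ι → ℂ} (hv : v ≠ 0) (h : A *ᵥ v = μ • v) : 0 ≤ μ := by
  have h1 := hA.dotProduct_mulVec_nonneg v
  rw [h, dotProduct_smul, smul_eq_mul] at h1
  exact le_of_mul_le_mul_right (by rwa [zero_mul]) (Matrix.dotProduct_star_self_pos_iff.2 hv)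

theorem exists_eq_wssTest {T : TensorOp d M} (hTest : IsTest T)
    (hU : ∀ U ∈ Matrix.unitaryGroup (Fin d) ℂ, Commute T (tensorPower M U))
    (hT : ∀ (g : Equiv.Perm (Fin M)) i j, T (i ∘ g) (j ∘ g) = T i j) :
    ∃ c : M.Partition → ℝ, (∀ p, 0 ≤ c p ∧ c p ≤ 1) ∧ T = wssTest d c := by
  have key (p : M.Partition) : ∃ c : ℝ, (0 ≤ c ∧ c ≤ 1) ∧ ∀ v ∈ schurBlock d p,
      Matrix.toEuclideanCLM (n := Fin M → Fin d) (𝕜 := ℂ) T v = (c : ℂ) • v := by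
    obtain ⟨μ, hμ⟩ := exists_forall_mem_schurBlock_eq_smul hU hT p
    -- On a zero block the scalar is arbitrary and need not lie in `[0, 1]`, so `0` is chosen. On a
    -- nonzero block `μ` and `1 - μ` are eigenvalues of `T` and `1 - T`.
    by_cases hbot : schurBlock d p = ⊥
    · refine ⟨0, ⟨le_rfl, zero_le_one⟩, fun v hv => ?_⟩
      rw [hbot, Submodule.mem_bot] at hv
      rw [hv, map_zero, smul_zero]
    · obtain ⟨v, hv, hv0⟩ := Submodule.exists_mem_ne_zero_of_ne_bot hbot
      have hTv : T *ᵥ v.ofLp = μ • v.ofLp := congrArg WithLp.ofLp (hμ v hv)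
      have hv0' : v.ofLp ≠ 0 := fun h => hv0 (WithLp.ofLp_injective 2 h)
      have h0 : 0 ≤ μ := nonneg_of_posSemidef_of_mulVec_eq_smul hTest.1 hv0' hTv
      have h1 : 0 ≤ 1 - μ := nonneg_of_posSemidef_of_mulVec_eq_smul hTest.2 hv0'
        (by rw [Matrix.sub_mulVec, Matrix.one_mulVec, hTv, sub_smul, one_smul])
      obtain ⟨c, rfl⟩ : ∃ c : ℝ, (c : ℂ) = μ := ⟨μ.re, (Complex.eq_re_of_ofReal_le h0).symm⟩
      refine ⟨c, ⟨by exact_mod_cast h0, ?_⟩, hμ⟩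
      have := sub_nonneg.1 h1
      exact_mod_cast this
  choose c hc hcv using key
  refine ⟨c, hc, EquivLike.injective (Matrix.toEuclideanCLM (n := Fin M → Fin d) (𝕜 := ℂ)) ?_⟩
  ext1 v
  conv_lhs => rw [← sum_starProjection_schurBlock v]
  rw [map_sum, wssTest, map_sum, sum_apply]
  refine Finset.sum_congr rfl fun p _ => ?_
  rw [hcv p _ (Submodule.starProjection_apply_mem _ v), map_smul, schurProj,
    StarAlgEquiv.apply_symm_apply, smul_apply]

end InvariantTests

/-! ### Twirling by minimization of the Hilbert-Schmidt norm -/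

section HilbertSchmidt

variable {ι : Type*} [Fintype ι]

/-- The square of the Hilbert-Schmidt norm. -/
def hsNormSq (A : Matrix ι ι ℂ) : ℝ := ∑ i, ∑ j, ‖A i j‖ ^ 2

theorem hsNormSq_eq_trace (A : Matrix ι ι ℂ) : (hsNormSq A : ℂ) = (Aᴴ * A).trace := by
  simp only [hsNormSq, Matrix.trace, Matrix.diag_apply, Matrix.mul_apply,
    Matrix.conjTranspose_apply]
  rw [Finset.sum_comm]
  push_cast
  refine Finset.sum_congr rfl fun i _ => Finset.sum_congr rfl fun j _ => ?_
  exact (Complex.conj_mul' _).symm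

theorem continuous_hsNormSq : Continuous (hsNormSq : Matrix ι ι ℂ → ℝ) := by
  unfold hsNormSq
  fun_prop

theorem norm_sq_le_hsNormSq (A : Matrix ι ι ℂ) (i j : ι) : ‖A i j‖ ^ 2 ≤ hsNormSq A :=
  (Finset.single_le_sum (f := fun j => ‖A i j‖ ^ 2) (fun _ _ => sq_nonneg _)
    (Finset.mem_univ j)).trans (Finset.single_le_sum (f := fun i => ∑ j, ‖A i j‖ ^ 2)
      (fun _ _ => Finset.sum_nonneg fun _ _ => sq_nonneg _) (Finset.mem_univ i))

theorem isCompact_hsNormSq_le (r : ℝ) : IsCompact {A : Matrix ι ι ℂ | hsNormSq A ≤ r} := by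
  have hK : IsCompact (Set.univ.pi fun _ : ι => Set.univ.pi fun _ : ι =>
      Metric.closedBall (0 : ℂ) (Real.sqrt r)) :=
    isCompact_univ_pi fun _ => isCompact_univ_pi fun _ => isCompact_closedBall _ _
  refine hK.of_isClosed_subset (isClosed_le continuous_hsNormSq continuous_const) ?_
  intro A hA i _ j _
  rw [mem_closedBall_zero_iff]
  exact Real.le_sqrt_of_sq_le ((norm_sq_le_hsNormSq A i j).trans hA)

theorem hsNormSq_midpoint (A B : Matrix ι ι ℂ) :
    hsNormSq ((1 / 2 : ℂ) • (A + B)) = (hsNormSq A + hsNormSq B) / 2 - hsNormSq (A - B) / 4 := by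
  simp only [hsNormSq, ← Finset.sum_add_distrib, Finset.sum_div, ← Finset.sum_sub_distrib]
  refine Finset.sum_congr rfl fun i _ => Finset.sum_congr rfl fun j _ => ?_
  have := parallelogram_law_with_norm ℝ (A i j) (B i j)
  simp only [Matrix.smul_apply, Matrix.add_apply, Matrix.sub_apply, norm_smul]
  norm_num
  nlinarith

theorem eq_zero_of_hsNormSq_le_zero {A : Matrix ι ι ℂ} (h : hsNormSq A ≤ 0) : A = 0 := by
  ext i j
  have := (norm_sq_le_hsNormSq A i j).trans h
  simpa using le_antisymm this (sq_nonneg _)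

/-- A nonempty closed midpoint-convex set of matrices has an element that is fixed by all maps
that preserve the set and the Hilbert-Schmidt norm. -/
theorem exists_mem_forall_fixed {K : Set (Matrix ι ι ℂ)} (hne : K.Nonempty) (hclosed : IsClosed K)
    (hconv : ∀ A ∈ K, ∀ B ∈ K, (1 / 2 : ℂ) • (A + B) ∈ K) :
    ∃ T ∈ K, ∀ f : Matrix ι ι ℂ → Matrix ι ι ℂ, (∀ A ∈ K, f A ∈ K) →
      (∀ A, hsNormSq (f A) = hsNormSq A) → f T = T := by
  obtain ⟨A₀, hA₀⟩ := hne
  obtain ⟨T, hT, hmin⟩ := ((isCompact_hsNormSq_le (hsNormSq A₀)).inter_left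
    hclosed).exists_isMinOn ⟨A₀, hA₀, le_refl (hsNormSq A₀)⟩ continuous_hsNormSq.continuousOn
  have hmin' (A : Matrix ι ι ℂ) (hA : A ∈ K) : hsNormSq T ≤ hsNormSq A := by
    rcases le_total (hsNormSq A) (hsNormSq A₀) with h | h
    · exact hmin ⟨hA, h⟩
    · exact hT.2.trans h
  refine ⟨T, hT.1, fun f hf hnorm => ?_⟩
  have h1 := hmin' _ (hconv _ (hf T hT.1) _ hT.1)
  rw [hsNormSq_midpoint, hnorm] at h1
  exact sub_eq_zero.1 (eq_zero_of_hsNormSq_le_zero (by linarith))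

theorem hsNormSq_conj [DecidableEq ι] {W : Matrix ι ι ℂ} (hW : Wᴴ * W = 1) (A : Matrix ι ι ℂ) :
    hsNormSq (W * A * Wᴴ) = hsNormSq A := by
  have h : ((hsNormSq (W * A * Wᴴ) : ℝ) : ℂ) = hsNormSq A := by
    rw [hsNormSq_eq_trace, hsNormSq_eq_trace]
    calc
      _ = (W * (Aᴴ * (Wᴴ * W) * A * Wᴴ)).trace := by
        simp only [Matrix.conjTranspose_mul, Matrix.conjTranspose_conjTranspose, mul_assoc]
      _ = _ := by rw [Matrix.trace_mul_comm, mul_assoc _ Wᴴ W, hW, mul_one, mul_one]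
  exact_mod_cast h

theorem hsNormSq_submatrix (e : ι ≃ ι) (A : Matrix ι ι ℂ) :
    hsNormSq (A.submatrix e e) = hsNormSq A := by
  simp only [hsNormSq, Matrix.submatrix_apply]
  rw [e.sum_comp fun i => ∑ j, ‖A i (e j)‖ ^ 2]
  exact Finset.sum_congr rfl fun i _ => e.sum_comp fun j => ‖A i j‖ ^ 2

theorem isClosed_posSemidef : IsClosed {A : Matrix ι ι ℂ | A.PosSemidef} := by
  simp only [Matrix.posSemidef_iff_dotProduct_mulVec, Set.ofPred_and, Set.ofPred_forall]
  refine IsClosed.inter (isClosed_eq (by fun_prop) continuous_id) (isClosed_iInter fun x => ?_)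
  exact isClosed_le continuous_const (by fun_prop)

end HilbertSchmidt

/-! ### Acceptance probabilities -/

section AcceptProb

variable {d M : ℕ}

theorem trace_tensorPower (A : Op d) : (tensorPower M A).trace = A.trace ^ M := by
  simp only [Matrix.trace, Matrix.diag_apply, tensorPower, Matrix.of_apply]
  have h := Finset.prod_univ_sum (fun _ : Fin M => Finset.univ) fun _ a => A a a
  rw [Fintype.piFinset_univ, Finset.prod_const, Finset.card_univ, Fintype.card_fin] at h
  exact h.symm

-- Writing `ρ = Bᴴ B` turns the probability into the trace of `B^{⊗M} O (B^{⊗M})ᴴ`, which is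
-- positive semidefinite.
open scoped MatrixOrder in
theorem acceptProb_nonneg {O : TensorOp d M} (hO : O.PosSemidef) {ρ : Op d} (hρ : IsDensity ρ) :
    0 ≤ acceptProb O ρ := by
  obtain ⟨B, rfl⟩ := CStarAlgebra.nonneg_iff_eq_star_mul_self.1 hρ.1.nonneg
  rw [acceptProb, Matrix.star_eq_conjTranspose, tensorPower_mul, tensorPower_conjTranspose,
    ← mul_assoc, Matrix.trace_mul_comm, ← mul_assoc]
  exact (Complex.nonneg_iff.1 (hO.mul_mul_conjTranspose_same _).trace_nonneg).1

theorem acceptProb_one {ρ : Op d} (hρ : IsDensity ρ) : acceptProb (1 : TensorOp d M) ρ = 1 := by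
  rw [acceptProb, one_mul, trace_tensorPower, hρ.2, one_pow, Complex.one_re]

theorem acceptProb_sub (A B : TensorOp d M) (ρ : Op d) :
    acceptProb (A - B) ρ = acceptProb A ρ - acceptProb B ρ := by
  simp [acceptProb, sub_mul]

theorem acceptProb_le_one {O : TensorOp d M} (hO : IsTest O) {ρ : Op d} (hρ : IsDensity ρ) :
    acceptProb O ρ ≤ 1 := by
  have := acceptProb_nonneg hO.2 hρ
  rw [acceptProb_sub, acceptProb_one hρ] at this
  linarith

theorem acceptProb_midpoint (A B : TensorOp d M) (ρ : Op d) :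
    acceptProb ((1 / 2 : ℂ) • (A + B)) ρ = (acceptProb A ρ + acceptProb B ρ) / 2 := by
  simp only [acceptProb, Matrix.smul_mul, add_mul, Matrix.trace_smul, Matrix.trace_add, smul_eq_mul]
  norm_num
  ring

theorem continuous_acceptProb (ρ : Op d) :
    Continuous fun O : TensorOp d M => acceptProb O ρ := by
  unfold acceptProb
  exact Complex.continuous_re.comp (continuous_id.matrix_mul continuous_const).matrix_trace

theorem acceptProb_conj (O : TensorOp d M) (U ρ : Op d) :
    acceptProb (tensorPower M U * O * (tensorPower M U)ᴴ) ρ = acceptProb O (Uᴴ * ρ * U) := by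
  rw [acceptProb, acceptProb, tensorPower_mul, tensorPower_mul, tensorPower_conjTranspose,
    mul_assoc, mul_assoc, Matrix.trace_mul_comm]
  simp only [mul_assoc]

theorem acceptProb_submatrix (O : TensorOp d M) (g : Equiv.Perm (Fin M)) (ρ : Op d) :
    acceptProb (O.submatrix (permIndex d g) (permIndex d g)) ρ = acceptProb O ρ := by
  have h : (tensorPower M ρ).submatrix (permIndex d g) (permIndex d g) = tensorPower M ρ := by
    ext i j
    exact Equiv.prod_comp g fun k => ρ (i k) (j k)
  rw [acceptProb, acceptProb, ← h, Matrix.submatrix_mul_equiv, h, Matrix.trace, Matrix.trace]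
  exact congrArg _ ((permIndex d g).sum_comp fun i => (O * tensorPower M ρ).diag i)

theorem IsTest.midpoint {A B : TensorOp d M} (hA : IsTest A) (hB : IsTest B) :
    IsTest ((1 / 2 : ℂ) • (A + B)) := by
  have h0 : (0 : ℂ) ≤ 1 / 2 := by rw [Complex.nonneg_iff]; norm_num
  refine ⟨(hA.1.add hB.1).smul h0, ?_⟩
  have : 1 - (1 / 2 : ℂ) • (A + B) = (1 / 2 : ℂ) • ((1 - A) + (1 - B)) := by module
  rw [this]
  exact (hA.2.add hB.2).smul h0

theorem isClosed_isTest : IsClosed {O : TensorOp d M | IsTest O} :=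
  isClosed_posSemidef.inter
    (isClosed_posSemidef.preimage (continuous_const.sub continuous_id))

theorem tensorPower_mul_conjTranspose {U : Op d} (hU : U ∈ Matrix.unitaryGroup (Fin d) ℂ) :
    tensorPower M U * (tensorPower M U)ᴴ = 1 := by
  rw [← tensorPower_conjTranspose, ← tensorPower_mul, ← Matrix.star_eq_conjTranspose,
    Matrix.mem_unitaryGroup_iff.1 hU, tensorPower_one]

theorem tensorPower_conjTranspose_mul {U : Op d} (hU : U ∈ Matrix.unitaryGroup (Fin d) ℂ) :
    (tensorPower M U)ᴴ * tensorPower M U = 1 := by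
  rw [← tensorPower_conjTranspose, ← tensorPower_mul, ← Matrix.star_eq_conjTranspose,
    Matrix.mem_unitaryGroup_iff'.1 hU, tensorPower_one]

theorem IsTest.conj {O : TensorOp d M} (hO : IsTest O) {U : Op d}
    (hU : U ∈ Matrix.unitaryGroup (Fin d) ℂ) :
    IsTest (tensorPower M U * O * (tensorPower M U)ᴴ) := by
  refine ⟨hO.1.mul_mul_conjTranspose_same _, ?_⟩
  have := hO.2.mul_mul_conjTranspose_same (tensorPower M U)
  rwa [mul_sub, sub_mul, mul_one, tensorPower_mul_conjTranspose hU] at this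

theorem IsTest.submatrix {O : TensorOp d M} (hO : IsTest O) (g : Equiv.Perm (Fin M)) :
    IsTest (O.submatrix (permIndex d g) (permIndex d g)) := by
  refine ⟨hO.1.submatrix _, ?_⟩
  have := hO.2.submatrix (permIndex d g)
  rwa [Matrix.submatrix_sub, Pi.sub_apply, Pi.sub_apply, Matrix.submatrix_one_equiv] at this

/-- Given any bounds on the acceptance probabilities of a test on unitarily invariant hypotheses,
some weak Schur sampling test satisfies the same bounds. -/
theorem exists_wssTest_of_bounds {S₀ S₁ : Set (Op d)} (hS₀ : IsUnitarilyInvariantHypothesis S₀)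
    (hS₁ : IsUnitarilyInvariantHypothesis S₁) {O : TensorOp d M} (hO : IsTest O) {a b : ℝ}
    (ha : ∀ ρ ∈ S₀, 1 - acceptProb O ρ ≤ a) (hb : ∀ ρ ∈ S₁, acceptProb O ρ ≤ b) :
    ∃ c : M.Partition → ℝ, (∀ p, 0 ≤ c p ∧ c p ≤ 1) ∧
      (∀ ρ ∈ S₀, 1 - acceptProb (wssTest d c) ρ ≤ a) ∧
      (∀ ρ ∈ S₁, acceptProb (wssTest d c) ρ ≤ b) := by
  -- The bounds are imposed state by state, so `K` is closed as an intersection. Conjugation by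
  -- `U^{⊗M}` only exchanges bounds at `ρ` and `Uᴴ ρ U`, and permuting factors changes no
  -- probability.
  let K : Set (TensorOp d M) := {X | IsTest X} ∩
    ((⋂ ρ ∈ S₀, {X | 1 - acceptProb X ρ ≤ a}) ∩ ⋂ ρ ∈ S₁, {X | acceptProb X ρ ≤ b})
  have hmem (X : TensorOp d M) : X ∈ K ↔ IsTest X ∧ (∀ ρ ∈ S₀, 1 - acceptProb X ρ ≤ a) ∧
      ∀ ρ ∈ S₁, acceptProb X ρ ≤ b := by
    simp [K]
  have hclosed : IsClosed K := isClosed_isTest.inter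
    ((isClosed_biInter fun ρ _ => isClosed_le (continuous_const.sub (continuous_acceptProb ρ))
      continuous_const).inter
    (isClosed_biInter fun ρ _ => isClosed_le (continuous_acceptProb ρ) continuous_const))
  obtain ⟨T, hTK, hfix⟩ := exists_mem_forall_fixed ⟨O, (hmem O).2 ⟨hO, ha, hb⟩⟩ hclosed
    fun A hA B hB => by
      rw [hmem] at hA hB ⊢
      refine ⟨hA.1.midpoint hB.1, fun ρ hρ => ?_, fun ρ hρ => ?_⟩
      · rw [acceptProb_midpoint]; linarith [hA.2.1 ρ hρ, hB.2.1 ρ hρ]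
      · rw [acceptProb_midpoint]; linarith [hA.2.2 ρ hρ, hB.2.2 ρ hρ]
  have hU (U : Op d) (hU : U ∈ Matrix.unitaryGroup (Fin d) ℂ) : Commute T (tensorPower M U) := by
    have hconj {S : Set (Op d)} (hS : IsUnitarilyInvariantHypothesis S) {ρ : Op d} (hρ : ρ ∈ S) :
        Uᴴ * ρ * U ∈ S := by
      simpa using hS.conj_mem ρ hρ Uᴴ (Unitary.star_mem hU)
    have h := hfix (fun X => tensorPower M U * X * (tensorPower M U)ᴴ) (fun X hX => by
      rw [hmem] at hX ⊢
      refine ⟨hX.1.conj hU, fun ρ hρ => ?_, fun ρ hρ => ?_⟩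
      · rw [acceptProb_conj]; exact hX.2.1 _ (hconj hS₀ hρ)
      · rw [acceptProb_conj]; exact hX.2.2 _ (hconj hS₁ hρ))
      (hsNormSq_conj (tensorPower_conjTranspose_mul hU))
    change T * tensorPower M U = tensorPower M U * T
    nth_rw 1 [← h]
    rw [mul_assoc, tensorPower_conjTranspose_mul hU, mul_one]
  have hperm (g : Equiv.Perm (Fin M)) (i j : Fin M → Fin d) : T (i ∘ g) (j ∘ g) = T i j := by
    have h := hfix (fun X => X.submatrix (permIndex d g) (permIndex d g)) (fun X hX => by
      rw [hmem] at hX ⊢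
      refine ⟨hX.1.submatrix g, fun ρ hρ => ?_, fun ρ hρ => ?_⟩
      · rw [acceptProb_submatrix]; exact hX.2.1 ρ hρ
      · rw [acceptProb_submatrix]; exact hX.2.2 ρ hρ)
      (hsNormSq_submatrix _)
    exact congrFun (congrFun h i) j
  rw [hmem] at hTK
  obtain ⟨c, hc, rfl⟩ := exists_eq_wssTest hTK.1 hU hperm
  exact ⟨c, hc, hTK.2⟩

end AcceptProb

/-! ### Worst-case errors -/

section Errors

variable {d M : ℕ} {S : Set (Op d)}

theorem bddAbove_type1Error (hS : ∀ ρ ∈ S, IsDensity ρ) {O : TensorOp d M} (hO : IsTest O) :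
    BddAbove (Set.range fun ρ : S => 1 - acceptProb O ρ.1) := by
  refine ⟨1, ?_⟩
  rintro _ ⟨ρ, rfl⟩
  exact sub_le_self _ (acceptProb_nonneg hO.1 (hS _ ρ.2))

theorem bddAbove_type2Error (hS : ∀ ρ ∈ S, IsDensity ρ) {O : TensorOp d M} (hO : IsTest O) :
    BddAbove (Set.range fun ρ : S => acceptProb O ρ.1) := by
  refine ⟨1, ?_⟩
  rintro _ ⟨ρ, rfl⟩
  exact acceptProb_le_one hO (hS _ ρ.2)

/-- An empty hypothesis needs its own case: both real suprema are then `0`. -/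
theorem iSup_le_iSup_of_forall_le {ι : Type*} {f g : ι → ℝ} (h : ∀ i, f i ≤ ⨆ j, g j) :
    ⨆ i, f i ≤ ⨆ j, g j := by
  rcases isEmpty_or_nonempty ι with hι | hι
  · rw [Real.iSup_of_isEmpty, Real.iSup_of_isEmpty]
  · exact ciSup_le h

theorem exists_wssTest_le {S₀ S₁ : Set (Op d)} (hS₀ : IsUnitarilyInvariantHypothesis S₀)
    (hS₁ : IsUnitarilyInvariantHypothesis S₁) {O : TensorOp d M} (hO : IsTest O) :
    ∃ c : M.Partition → ℝ, (∀ p, 0 ≤ c p ∧ c p ≤ 1) ∧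
      type1Error S₀ (wssTest d c) ≤ type1Error S₀ O ∧
      type2Error S₁ (wssTest d c) ≤ type2Error S₁ O := by
  obtain ⟨c, hc, h0, h1⟩ := exists_wssTest_of_bounds hS₀ hS₁ hO
    (fun ρ hρ => le_ciSup (bddAbove_type1Error hS₀.isDensity hO) ⟨ρ, hρ⟩)
    (fun ρ hρ => le_ciSup (bddAbove_type2Error hS₁.isDensity hO) ⟨ρ, hρ⟩)
  exact ⟨c, hc, iSup_le_iSup_of_forall_le fun ρ => h0 ρ ρ.2,
    iSup_le_iSup_of_forall_le fun ρ => h1 ρ ρ.2⟩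

theorem continuous_wssTest : Continuous fun c : M.Partition → ℝ => wssTest d c := by
  unfold wssTest
  fun_prop

theorem exists_wssTest_forall_le {S₀ S₁ : Set (Op d)} (hS₀ : ∀ ρ ∈ S₀, IsDensity ρ)
    (hS₁ : ∀ ρ ∈ S₁, IsDensity ρ) :
    ∃ c : M.Partition → ℝ, (∀ p, 0 ≤ c p ∧ c p ≤ 1) ∧
      ∀ c' : M.Partition → ℝ, (∀ p, 0 ≤ c' p ∧ c' p ≤ 1) →
        max (type1Error S₀ (wssTest d c)) (type2Error S₁ (wssTest d c)) ≤
          max (type1Error S₀ (wssTest d c')) (type2Error S₁ (wssTest d c')) := by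
  have hIcc (c : M.Partition → ℝ) : c ∈ Set.Icc (0 : M.Partition → ℝ) 1 ↔
      ∀ p, 0 ≤ c p ∧ c p ≤ 1 := by
    simp only [Set.mem_Icc, Pi.le_def, Pi.zero_apply, Pi.one_apply, forall_and]
  have hcont (ρ : Op d) : Continuous fun c : M.Partition → ℝ => acceptProb (wssTest d c) ρ :=
    (continuous_acceptProb ρ).comp continuous_wssTest
  -- A bounded supremum of continuous functions of `c` is lower semicontinuous, which suffices for a
  -- minimum on the cube.
  have h1 : LowerSemicontinuousOn (fun c : M.Partition → ℝ => type1Error S₀ (wssTest d c))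
      (Set.Icc 0 1) := lowerSemicontinuousOn_ciSup
    (fun c hc => bddAbove_type1Error hS₀ (isTest_wssTest ((hIcc c).1 hc)))
    fun ρ => (continuous_const.sub (hcont ρ)).lowerSemicontinuous.lowerSemicontinuousOn _
  have h2 : LowerSemicontinuousOn (fun c : M.Partition → ℝ => type2Error S₁ (wssTest d c))
      (Set.Icc 0 1) := lowerSemicontinuousOn_ciSup
    (fun c hc => bddAbove_type2Error hS₁ (isTest_wssTest ((hIcc c).1 hc)))
    fun ρ => (hcont ρ).lowerSemicontinuous.lowerSemicontinuousOn _
  obtain ⟨c, hc, hmin⟩ := (h1.sup h2).exists_isMinOn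
    (Set.nonempty_Icc.2 zero_le_one) isCompact_Icc
  exact ⟨c, (hIcc c).1 hc, fun c' hc' => hmin ((hIcc c').2 hc')⟩

end Errors

end WeakSchur

end

theorem proposition2 (d M : ℕ) (S₀ S₁ : Set (WeakSchur.Op d))
    (hS₀ : WeakSchur.IsUnitarilyInvariantHypothesis S₀)
    (hS₁ : WeakSchur.IsUnitarilyInvariantHypothesis S₁) :
    -- weak Schur sampling is a projective measurement
    WeakSchur.IsProjectiveMeasurement
      (fun p : M.Partition => (WeakSchur.schurProj d p : WeakSchur.TensorOp d M)) ∧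
    -- every test can be replaced by a weak Schur sampling test with no larger worst-case errors
    (∀ O : WeakSchur.TensorOp d M, WeakSchur.IsTest O →
      ∃ c : M.Partition → ℝ, (∀ p, 0 ≤ c p ∧ c p ≤ 1) ∧
        WeakSchur.IsTest (WeakSchur.wssTest d c) ∧
        WeakSchur.type1Error S₀ (WeakSchur.wssTest d c) ≤ WeakSchur.type1Error S₀ O ∧
        WeakSchur.type2Error S₁ (WeakSchur.wssTest d c) ≤ WeakSchur.type2Error S₁ O) ∧
    -- some weak Schur sampling test attains the minimax error among all tests
    (∃ c : M.Partition → ℝ, (∀ p, 0 ≤ c p ∧ c p ≤ 1) ∧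
      WeakSchur.IsTest (WeakSchur.wssTest d c) ∧
      ∀ O : WeakSchur.TensorOp d M, WeakSchur.IsTest O →
        max (WeakSchur.type1Error S₀ (WeakSchur.wssTest d c))
            (WeakSchur.type2Error S₁ (WeakSchur.wssTest d c)) ≤
          max (WeakSchur.type1Error S₀ O) (WeakSchur.type2Error S₁ O)) := by
  refine ⟨WeakSchur.isProjectiveMeasurement_schurProj d M, fun O hO => ?_, ?_⟩
  · obtain ⟨c, hc, h⟩ := WeakSchur.exists_wssTest_le hS₀ hS₁ hO
    exact ⟨c, hc, WeakSchur.isTest_wssTest hc, h⟩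
  · obtain ⟨c, hc, hmin⟩ := WeakSchur.exists_wssTest_forall_le (M := M) hS₀.isDensity hS₁.isDensity
    refine ⟨c, hc, WeakSchur.isTest_wssTest hc, fun O hO => ?_⟩
    obtain ⟨c', hc', h⟩ := WeakSchur.exists_wssTest_le hS₀ hS₁ hO
    exact (hmin c' hc').trans (max_le_max h.1 h.2)
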